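/- Let $K$ be a field, $n\ge 0$, $S=K[x_0,\dots,x_n]$, and let $X=V(F)\subset\mathbb{P}^n_K$ be a hypersurface of degree $d\ge 1$, where $F\in S$ is a nonzero homogeneous polynomial of degree $d$. For a closed subscheme $Y\subseteq\mathbb{P}^n_K$ let $I_Y\subseteq S$ be its (saturated) homogeneous ideal, generated by all homogeneous polynomials vanishing on $Y$. Call $Y$ \emph{ACM} if its homogeneous coordinate ring $S/I_Y$ is Cohen--Macaulay, and a \emph{complete intersection} if $I_Y$ is generated by $\operatorname{codim}(Y,\mathbb{P}^n)=\operatorname{ht}(I_Y)$ homogeneous polynomials. A \emph{weak admissible pair} of degree $d$ and length $t\ge 2$ is a pair $(\hat a,\hat b)$ of sequences of integers $a_1\le\cdots\le a_t$, $b_1\le\cdots\le b_t$ with $a_i<b_i$ for all $i$ and $\sum_{i=1}^t(b_i-a_i)=d$. The hypersurface $X=V(F)$ is \emph{weak determinantal of type} $(\hat a,\hat b)$ if $F=\det(m_{ij})$ for some $t\times t$ matrix over $S$ such that $m_{ij}$ is homogeneous of degree $b_j-a_i$ if $a_i<b_j$, and $m_{ij}=0$ if $a_i\ge b_j$. **Proposition.**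 Suppose that there is a closed subscheme (not necessarily reduced or irreducible) $Y\subseteq X$ of codimension one in $X$ that is ACM and is not a complete intersection. Then $X$ is weak determinantal of type $(\hat a,\hat b)$ for some weak admissible pair $(\hat a,\hat b)$ of degree $d$ and some length $t\ge 2$. -/

import Mathlib

open CategoryTheory AlgebraicGeometry

universe u

attribute [local instance] MvPolynomial.gradedAlgebra

noncomputable section

/-- A Noetherian local ring is Cohen--Macaulay if its maximal ideal contains a regular sequence
whose length is the Krull dimension of the ring (that is, depth equals dimension). -/
def IsCohenMacaulayLocalRing (R : Type u) [CommRing R] [IsLocalRing R] : Prop :=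
  IsNoetherianRing R ∧ ∃ rs : List R,
    (∀ r ∈ rs, r ∈ IsLocalRing.maximalIdeal R) ∧ RingTheory.Sequence.IsRegular R rs ∧
      (rs.length : WithBot ℕ∞) = ringKrullDim R

/-- A Noetherian ring is Cohen--Macaulay if all its localizations at maximal ideals are. -/
def IsCohenMacaulayRing (R : Type u) [CommRing R] : Prop :=
  IsNoetherianRing R ∧
    ∀ (m : Ideal R) [m.IsMaximal], IsCohenMacaulayLocalRing (Localization.AtPrime m)

/-- The projective space `ℙⁿ` over a field `K`, as `Proj K[x₀, …, xₙ]`. -/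
abbrev projSpace (n : ℕ) (K : Type u) [Field K] : Scheme.{u} :=
  Proj (MvPolynomial.homogeneousSubmodule (Fin (n + 1)) K)

variable {n : ℕ} {K : Type u} [Field K]

/-- For a form `f` of degree `d`, the element `f / x_j ^ d` of the degree zero part of
`K[x₀, …, xₙ][1 / x_j]`. -/
def dehomogenize (f : MvPolynomial (Fin (n + 1)) K) (d : ℕ) (hf : f.IsHomogeneous d)
    (j : Fin (n + 1)) :
    HomogeneousLocalization.Away (MvPolynomial.homogeneousSubmodule (Fin (n + 1)) K)
      (MvPolynomial.X j : MvPolynomial (Fin (n + 1)) K) :=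
  HomogeneousLocalization.Away.mk (MvPolynomial.homogeneousSubmodule (Fin (n + 1)) K)
    (d := 1) ((MvPolynomial.mem_homogeneousSubmodule 1 _).2 (MvPolynomial.isHomogeneous_X K j)) d f
    ((MvPolynomial.mem_homogeneousSubmodule _ _).2 (by simpa using hf))

/-- The form `f` of degree `d` vanishes on the subscheme `i : Y ⟶ ℙⁿ`: on each chart `x_j ≠ 0`,
the function `f / x_j ^ d` pulls back to zero on `Y`. For `f ≠ 0` this says that `Y` is a closed
subscheme of the hypersurface `V(f)`. -/
def FormVanishesOn {Y : Scheme.{u}} (i : Y ⟶ projSpace n K)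
    (f : MvPolynomial (Fin (n + 1)) K) (d : ℕ) (hf : f.IsHomogeneous d) : Prop :=
  ∀ j : Fin (n + 1),
    i.app (Proj.basicOpen (MvPolynomial.homogeneousSubmodule (Fin (n + 1)) K) (MvPolynomial.X j))
      (Proj.awayToSection (MvPolynomial.homogeneousSubmodule (Fin (n + 1)) K) (MvPolynomial.X j)
        (dehomogenize f d hf j)) = 0

/-- The (saturated) homogeneous ideal of the subscheme `i : Y ⟶ ℙⁿ`, generated by all forms that
vanish on `Y`. -/
def homogeneousIdealOf {Y : Scheme.{u}} (i : Y ⟶ projSpace n K) :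
    Ideal (MvPolynomial (Fin (n + 1)) K) :=
  Ideal.span {f | ∃ (d : ℕ) (hf : f.IsHomogeneous d), FormVanishesOn i f d hf}

/-- `Y` is arithmetically Cohen--Macaulay: its homogeneous coordinate ring is Cohen--Macaulay. -/
def IsACM {Y : Scheme.{u}} (i : Y ⟶ projSpace n K) : Prop :=
  IsCohenMacaulayRing (MvPolynomial (Fin (n + 1)) K ⧸ homogeneousIdealOf i)

/-- `Y` is a complete intersection in `ℙⁿ`: its homogeneous ideal is generated by as many forms as
the codimension of `Y` in `ℙⁿ`. -/
def IsCompleteIntersectionIn {Y : Scheme.{u}} (i : Y ⟶ projSpace n K) : Prop :=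
  ∃ (r : ℕ) (g : Fin r → MvPolynomial (Fin (n + 1)) K),
    (∀ k, ∃ e : ℕ, (g k).IsHomogeneous e) ∧
      Ideal.span (Set.range g) = homogeneousIdealOf i ∧
      (homogeneousIdealOf i).height = (r : ℕ∞)

/-- The codimension of `Y` in the hypersurface `V(F)`: the height of the ideal of `Y` in the
homogeneous coordinate ring `K[x₀, …, xₙ] / (F)` of the hypersurface. -/
def codimInHypersurface {Y : Scheme.{u}} (i : Y ⟶ projSpace n K)
    (F : MvPolynomial (Fin (n + 1)) K) : ℕ∞ :=
  ((homogeneousIdealOf i).map (Ideal.Quotient.mk (Ideal.span {F}))).height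

/-- Weak admissible pairs of length `t`. -/
structure IsWeakAdmissiblePair {t : ℕ} (a b : Fin t → ℤ) : Prop where
  two_le : 2 ≤ t
  monotone_left : Monotone a
  monotone_right : Monotone b
  lt : ∀ i, a i < b i

/-- The degree of a weak admissible pair. -/
def pairDegree {t : ℕ} (a b : Fin t → ℤ) : ℤ := ∑ i, (b i - a i)

/-- The hypersurface `V(F)` is weak determinantal of type `(a, b)`: `F` is the determinant of a
matrix whose entry at `(i, j)` is a form of degree `b j - a i`, and is zero if `b j ≤ a i`. -/
def IsWeakDeterminantal (F : MvPolynomial (Fin (n + 1)) K) {t : ℕ} (a b : Fin t → ℤ) : Prop :=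
  ∃ S : Matrix (Fin t) (Fin t) (MvPolynomial (Fin (n + 1)) K),
    F = S.det ∧
      (∀ i j, a i < b j → (S i j).IsHomogeneous (b j - a i).toNat) ∧
      (∀ i j, b j ≤ a i → S i j = 0)

end

/-! ### Projective dimension and depth over Noetherian local rings. -/

section HomologicalDimension

open IsLocalRing RingTheory.Sequence
open scoped Pointwise

variable {R : Type u} [CommRing R]

/-! This is the Hilbert–Burch theorem, applied to a generating set that is made to contain `F`. Let
`I` be the ideal of `Y`, which has height two. Choose forms `g` in `I`, irredundant modulo `F`, such
that `G = (F, g₁, …, g_t)` generates `I`. If `t ≤ 1`, then either `I` is principal, against its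
height, or `I` is a complete intersection; so `t ≥ 2`.

At the origin the Cohen–Macaulay hypothesis gives `S/I` projective dimension at most two, so the
syzygies of `G` become projective there. An irredundant family of homogeneous generators of the
syzygies is therefore a basis (`linearIndependent_of_minimal`), and a rank count shows that it has
`t` members. Since no prime element divides all of `I`, the minor of the syzygy matrix that omits
the row of `F` equals `F` up to a unit (`associated_det_of_span_eq_ker`). Irredundancy modulo `F`
kills the constant entries in the remaining rows; sorting the degrees and using `F ≠ 0` then gives
`a i < b i`.

The bound on projective dimension comes from the Koszul resolution of the residue field, of length
`N = n + 1`. Every finitely generated module then has projective dimension at most `N`, and a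
regular sequence of length `l` improves this to `N - l`. It remains to see that the quotient by `I`
has dimension at least `N - 2`: a homogeneous height-two prime over `I` is associated to the
quotient by a regular sequence of length two, and associated primes of a module of projective
dimension `s` have dimension at least `N - s`. -/

lemma shortExact_of_linearMap {M₁ M₂ M₃ : Type u} [AddCommGroup M₁] [Module R M₁]
    [AddCommGroup M₂] [Module R M₂] [AddCommGroup M₃] [Module R M₃]
    {f : M₁ →ₗ[R] M₂} {g : M₂ →ₗ[R] M₃} (hf : Function.Injective f) (hg : Function.Surjective g)
    (hfg : Function.Exact f g) :
    (ModuleCat.shortComplexOfCompEqZero f g hfg.linearMap_comp_eq_zero).ShortExact :=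
  ModuleCat.shortComplex_shortExact _ hfg hf hg

lemma hasProjectiveDimensionLE_of_linearEquiv {M M' : Type u} [AddCommGroup M] [Module R M]
    [AddCommGroup M'] [Module R M'] (e : M ≃ₗ[R] M') (k : ℕ)
    (h : HasProjectiveDimensionLE (ModuleCat.of R M) k) :
    HasProjectiveDimensionLE (ModuleCat.of R M') k :=
  hasProjectiveDimensionLT_of_iso e.toModuleIso _

/-- The second syzygy module of a module of projective dimension at most two is projective. -/
lemma projective_ker_of_hasProjectiveDimensionLE_two {ι : Type} [Finite ι] (φ : (ι → R) →ₗ[R] R)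
    (h : HasProjectiveDimensionLE (ModuleCat.of R (R ⧸ LinearMap.range φ)) 2) :
    Module.Projective R (LinearMap.ker φ) := by
  have hS₁ := shortExact_of_linearMap (R := R)
    (f := (LinearMap.range φ).subtype) (g := (LinearMap.range φ).mkQ)
    (Submodule.subtype_injective _) (Submodule.mkQ_surjective _) (LinearMap.exact_subtype_mkQ _)
  have hS₂ := shortExact_of_linearMap (R := R)
    (f := (LinearMap.ker φ).subtype) (g := φ.rangeRestrict)
    (Submodule.subtype_injective _) φ.surjective_rangeRestrict (fun x => by
      rw [← LinearMap.mem_ker, LinearMap.ker_rangeRestrict]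
      simp)
  have hR : Projective (ModuleCat.of R R) := (IsProjective.iff_projective _).mp inferInstance
  have hRn : Projective (ModuleCat.of R (ι → R)) :=
    (IsProjective.iff_projective _).mp inferInstance
  have h₁ := (hS₁.hasProjectiveDimensionLT_X₃_iff 1 hR).mp h
  have h₂ := (hS₂.hasProjectiveDimensionLT_X₃_iff 0 hRn).mp h₁
  rw [IsProjective.iff_projective]
  exact projective_iff_hasProjectiveDimensionLT_one.mpr h₂

variable [IsLocalRing R] [IsNoetherianRing R]

/-- If the residue field of a Noetherian local ring has projective dimension at most `N`, then so
does every finitely generated module. -/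
lemma hasProjectiveDimensionLE_of_residueField {N : ℕ}
    (hk : HasProjectiveDimensionLE (ModuleCat.of R (R ⧸ maximalIdeal R)) N)
    (M : Type u) [AddCommGroup M] [Module R M] [Module.Finite R M] :
    HasProjectiveDimensionLE (ModuleCat.of R M) N := by
  -- Noetherian induction on an ideal killing `M`: larger ideals are treated first, and a prime
  -- filtration reduces `M` to `R ⧸ p`.
  suffices H : ∀ (I : Ideal R) (M : Type u) [AddCommGroup M] [Module R M] [Module.Finite R M],
      I ≤ Module.annihilator R M → HasProjectiveDimensionLE (ModuleCat.of R M) N from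
    H ⊥ M bot_le
  intro I
  induction I using WellFoundedGT.induction with
  | ind I ih =>
  intro M _ _ hM
  induction hM using IsNoetherianRing.induction_on_isQuotientEquivQuotientPrime R with
  | subsingleton M =>
    intro _
    have : HasProjectiveDimensionLT (ModuleCat.of R M) 0 :=
      (ModuleCat.isZero_of_subsingleton (ModuleCat.of R M)).hasProjectiveDimensionLT_zero
    exact hasProjectiveDimensionLT_of_ge _ 0 _ (Nat.zero_le _)
  | exact M₁ M₂ M₃ f g hf hg hfg h₁ h₃ =>
    intro hI
    exact (shortExact_of_linearMap hf hg hfg).hasProjectiveDimensionLT_X₂ _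
      (h₁ (hI.trans (f.annihilator_le_of_injective hf)))
      (h₃ (hI.trans (g.annihilator_le_of_surjective hg)))
  | quotient M p e =>
    intro hI
    rw [e.annihilator_eq, Ideal.annihilator_quotient] at hI
    refine hasProjectiveDimensionLE_of_linearEquiv e.symm _ ?_
    by_cases hp : p.1 = maximalIdeal R
    · rwa [hp]
    obtain ⟨x, hx, hxp⟩ : ∃ x ∈ maximalIdeal R, x ∉ p.1 := by
      by_contra! h
      exact hp (le_antisymm (le_maximalIdeal p.2.ne_top) h)
    have hreg : IsSMulRegular (R ⧸ p.1) x := by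
      rw [isSMulRegular_quotient_iff_mem_of_smul_mem]
      intro y hy
      exact (p.2.mem_or_mem hy).resolve_left hxp
    -- Dividing `R ⧸ p` by `x` gives a module killed by a strictly larger ideal, and raises the
    -- projective dimension by one.
    have hlt : I < p.1 ⊔ Ideal.span {x} := by
      refine lt_of_le_of_ne (hI.trans le_sup_left) fun h => hxp (hI ?_)
      rw [h]
      exact Ideal.mem_sup_right (Ideal.mem_span_singleton_self x)
    have hq := ih _ hlt (QuotSMulTop x (R ⧸ p.1)) (by
      rw [sup_le_iff]
      constructor
      · refine le_trans (le_of_eq (Ideal.annihilator_quotient (I := p.1)).symm) ?_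
        exact (Submodule.mkQ _).annihilator_le_of_surjective (Submodule.mkQ_surjective _)
      · rw [Ideal.span_singleton_le_iff_mem]
        exact QuotSMulTop.mem_annihilator _ _)
    have hpd := ModuleCat.projectiveDimension_quotSMulTop_eq_succ_of_isSMulRegular
      (ModuleCat.of R (R ⧸ p.1)) x hreg hx
    rw [← projectiveDimension_le_iff] at hq ⊢
    refine le_trans ?_ (hpd.symm.le.trans hq)
    exact le_add_of_nonneg_right zero_le_one

/-- If `x` is a regular element in the maximal ideal, every associated prime of `M` lies in an
associated prime of `M / x M` containing `x`. -/
lemma exists_isAssociatedPrime_quotSMulTop {M : Type u} [AddCommGroup M] [Module R M]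
    [Module.Finite R M] {x : R} (hx : x ∈ maximalIdeal R) (hreg : IsSMulRegular M x)
    {p : Ideal R} (hp : IsAssociatedPrime p M) :
    ∃ q : Ideal R, IsAssociatedPrime q (QuotSMulTop x M) ∧ p ≤ q ∧ x ∈ q := by
  obtain ⟨hpp, z, hz⟩ := isAssociatedPrime_iff.mp hp
  -- `L` is the part of `M` killed by `p`. If `L ⊆ x M`, regularity of `x` gives `L = x L`, so `L =
  -- 0` by Nakayama. Hence some `u ∈ L` survives in `M / x M`.
  let L : Submodule R M :=
    { carrier := {u | ∀ a ∈ p, a • u = 0}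
      add_mem' := fun {u v} hu hv a ha => by rw [smul_add, hu a ha, hv a ha, add_zero]
      zero_mem' := fun a _ => smul_zero a
      smul_mem' := fun c u hu a ha => by rw [smul_comm, hu a ha, smul_zero] }
  have hzL : z ∈ L := fun a ha => by
    rw [hz] at ha
    simpa using ha
  have hz0 : z ≠ 0 := by
    rintro rfl
    apply hpp.ne_top
    simp [hz]
  obtain ⟨u, huL, hu⟩ : ∃ u ∈ L, u ∉ x • (⊤ : Submodule R M) := by
    by_contra! h
    apply hz0
    have hL : L = ⊥ := by
      refine Submodule.eq_bot_of_le_smul_of_le_jacobson_bot (maximalIdeal R) L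
        (IsNoetherian.noetherian L) (fun u hu => ?_) (IsLocalRing.maximalIdeal_le_jacobson _)
      obtain ⟨v, -, hv⟩ := h u hu
      have hv : x • v = u := hv
      rw [← hv]
      refine Submodule.smul_mem_smul hx fun a ha => hreg ?_
      change x • a • v = x • 0
      rw [smul_comm, hv, hu a ha, smul_zero]
    simpa [hL] using hzL
  obtain ⟨q, hq, hle⟩ := exists_le_isAssociatedPrime_of_isNoetherianRing R
    (M := QuotSMulTop x M) (Submodule.Quotient.mk u) (by
      rwa [Ne, Submodule.Quotient.mk_eq_zero])
  refine ⟨q, hq, fun a ha => hle ?_, hle ?_⟩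
  · rw [Submodule.mem_colon_singleton, Submodule.mem_bot, ← Submodule.Quotient.mk_smul, huL a ha,
      Submodule.Quotient.mk_zero]
  · rw [Submodule.mem_colon_singleton, Submodule.mem_bot]
    have := QuotSMulTop.mem_annihilator M x
    rw [Module.mem_annihilator] at this
    exact this _

/-- If the maximal ideal is associated to a finitely generated module of projective dimension less
than `N`, then the residue field does not have projective dimension exactly `N`. -/
lemma hasProjectiveDimensionLT_residueField_of_isAssociatedPrime {N : ℕ}
    (hk : HasProjectiveDimensionLE (ModuleCat.of R (R ⧸ maximalIdeal R)) N)
    {M : Type u} [AddCommGroup M] [Module R M] [Module.Finite R M]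
    (hM : HasProjectiveDimensionLT (ModuleCat.of R M) N)
    (hm : IsAssociatedPrime (maximalIdeal R) M) :
    HasProjectiveDimensionLT (ModuleCat.of R (R ⧸ maximalIdeal R)) N := by
  obtain ⟨-, z, hz⟩ := isAssociatedPrime_iff.mp hm
  have hker : LinearMap.ker (LinearMap.toSpanSingleton R M z) = maximalIdeal R := by
    rw [hz]
    ext a
    simp
  let e := (Submodule.quotEquivOfEq _ _ hker).symm.trans
    (LinearMap.toSpanSingleton R M z).quotKerEquivRange
  have hS := shortExact_of_linearMap (R := R)
    (f := (LinearMap.range (LinearMap.toSpanSingleton R M z)).subtype)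
    (g := (LinearMap.range (LinearMap.toSpanSingleton R M z)).mkQ)
    (Submodule.subtype_injective _) (Submodule.mkQ_surjective _) (LinearMap.exact_subtype_mkQ _)
  -- The submodule `R z` is a copy of the residue field. The cokernel has dimension at most `N`, one
  -- more than the bound on `M`, which is what the long exact sequence needs.
  have := hS.hasProjectiveDimensionLT_X₁ N hM
    (hasProjectiveDimensionLE_of_residueField hk
      (M ⧸ LinearMap.range (LinearMap.toSpanSingleton R M z)))
  exact hasProjectiveDimensionLT_of_iso e.symm.toModuleIso _

/-- Prime avoidance: the zero divisors on `M` form the finite union of its associated primes. -/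
lemma exists_isSMulRegular_of_not_isAssociatedPrime {M : Type u} [AddCommGroup M] [Module R M]
    [Module.Finite R M] (hm : ¬ IsAssociatedPrime (maximalIdeal R) M) :
    ∃ x ∈ maximalIdeal R, IsSMulRegular M x := by
  by_contra! h
  have hsub : (maximalIdeal R : Set R) ⊆ ⋃ p ∈ associatedPrimes R M, (p : Set R) := by
    rw [biUnion_associatedPrimes_eq_compl_regular]
    exact h
  obtain ⟨p, hp, hle⟩ := (Ideal.subset_union_prime_finite (associatedPrimes.finite R M)
    (f := id) ⊥ ⊥ fun _ h _ _ => h.isPrime).1 hsub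
  apply hm
  have : p = maximalIdeal R := le_antisymm (le_maximalIdeal hp.1.ne_top) hle
  rwa [← this]

/-- Over a Noetherian local ring whose residue field has projective dimension exactly `N`, an
associated prime of a module of projective dimension at most `N - r` has dimension at least `r`. -/
lemma le_ringKrullDim_quotient_of_isAssociatedPrime {N : ℕ}
    (hk : HasProjectiveDimensionLE (ModuleCat.of R (R ⧸ maximalIdeal R)) N)
    (hk' : ¬ HasProjectiveDimensionLT (ModuleCat.of R (R ⧸ maximalIdeal R)) N) (r s : ℕ)
    (hrs : r + s ≤ N) (M : Type u) [AddCommGroup M] [Module R M] [Module.Finite R M]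
    (hM : HasProjectiveDimensionLE (ModuleCat.of R M) s)
    {p : Ideal R} (hp : IsAssociatedPrime p M) : (r : WithBot ℕ∞) ≤ ringKrullDim (R ⧸ p) := by
  induction r generalizing s M p with
  | zero =>
    have := Ideal.Quotient.nontrivial_iff.mpr hp.isPrime.ne_top
    exact ringKrullDim_nonneg_of_nontrivial
  | succ r ih =>
    -- Here `s < N`, so the maximal ideal is not associated to `M`. Dividing by a regular `x` trades
    -- one unit of `r` for one of `s`, and leads to an associated prime strictly above `p`.
    obtain ⟨x, hx, hreg⟩ := exists_isSMulRegular_of_not_isAssociatedPrime (M := M) fun hm =>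
      hk' (hasProjectiveDimensionLT_residueField_of_isAssociatedPrime hk
        (hasProjectiveDimensionLT_of_ge (ModuleCat.of R M) (s + 1) N (by omega)) hm)
    obtain ⟨q, hq, hpq, hxq⟩ := exists_isAssociatedPrime_quotSMulTop hx hreg hp
    have hpd := ModuleCat.projectiveDimension_quotSMulTop_eq_succ_of_isSMulRegular
      (ModuleCat.of R M) x hreg hx
    have h1 := ih (s + 1) (by omega) (QuotSMulTop x M) (by
      rw [← projectiveDimension_le_iff] at hM ⊢
      refine hpd.le.trans ?_
      push_cast
      gcongr) hq
    have hxp : x ∉ p := fun h => by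
      have : x ∈ {r : R | IsSMulRegular M r}ᶜ := by
        rw [← biUnion_associatedPrimes_eq_compl_regular]
        exact Set.mem_biUnion hp h
      exact this hreg
    have := hp.isPrime
    refine le_trans ?_ (ringKrullDim_succ_le_of_surjective (Ideal.Quotient.factor hpq)
      (Ideal.Quotient.factor_surjective hpq) (r := Ideal.Quotient.mk p x)
      (mem_nonZeroDivisors_of_ne_zero (by rwa [Ne, Ideal.Quotient.eq_zero_iff_mem]))
      (by rw [Ideal.Quotient.factor_mk, Ideal.Quotient.eq_zero_iff_mem]; exact hxq))
    push_cast
    gcongr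

/-- If the residue field has finite projective dimension `N`, a module with a regular sequence of
length `l` in the maximal ideal has projective dimension at most `N - l`. -/
lemma hasProjectiveDimensionLE_of_isWeaklyRegular {N : ℕ}
    (hk : HasProjectiveDimensionLE (ModuleCat.of R (R ⧸ maximalIdeal R)) N)
    (M : Type u) [AddCommGroup M] [Module R M] [Module.Finite R M] [Nontrivial M]
    (rs : List R) (hrs : IsWeaklyRegular M rs) (hmem : ∀ r ∈ rs, r ∈ maximalIdeal R) (s : ℕ)
    (hs : N ≤ s + rs.length) : HasProjectiveDimensionLE (ModuleCat.of R M) s := by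
  have h1 := ModuleCat.projectiveDimension_quotient_eq_add_length_of_isWeaklyRegular
    (ModuleCat.of R M) rs hrs hmem
  have h2 := hasProjectiveDimensionLE_of_residueField hk
    (M ⧸ Ideal.ofList rs • (⊤ : Submodule R M))
  rw [← projectiveDimension_le_iff] at h2 ⊢
  have h3 : projectiveDimension (ModuleCat.of R M) + (rs.length : WithBot ℕ∞) ≤
      (s : WithBot ℕ∞) + (rs.length : WithBot ℕ∞) := by
    refine h1.symm.le.trans (h2.trans ?_)
    exact_mod_cast hs
  exact (ENat.WithBot.add_le_add_natCast_right_iff).mp h3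

/-- A minimal surjection from a free module onto a projective module is injective. -/
lemma injective_of_projective_of_ker_le {ι : Type*} [Finite ι] {P : Type*} [AddCommGroup P]
    [Module R P] [Module.Projective R P] (φ : (ι → R) →ₗ[R] P) (hφ : Function.Surjective φ)
    (hker : LinearMap.ker φ ≤ maximalIdeal R • (⊤ : Submodule R (ι → R))) :
    Function.Injective φ := by
  obtain ⟨σ, hσ⟩ := Module.projective_lifting_property φ LinearMap.id hφ
  rw [← LinearMap.ker_eq_bot]
  refine Submodule.eq_bot_of_le_smul_of_le_jacobson_bot (maximalIdeal R) _
    (IsNoetherian.noetherian _) (fun k hk => ?_) (IsLocalRing.maximalIdeal_le_jacobson _)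
  -- `id - σ ∘ φ` maps everything into the kernel of `φ` and fixes that kernel, so the kernel lies
  -- in `m` times itself and Nakayama applies.
  have hmap := Submodule.mem_map_of_mem (f := LinearMap.id - σ ∘ₗ φ) (hker hk)
  rw [Submodule.map_smul''] at hmap
  have hle : Submodule.map (LinearMap.id - σ ∘ₗ φ) ⊤ ≤ LinearMap.ker φ := by
    rintro _ ⟨v, -, rfl⟩
    have := LinearMap.congr_fun hσ (φ v)
    simp only [LinearMap.comp_apply, LinearMap.id_apply] at this
    simp [this]
  have := Submodule.smul_mono (le_refl (maximalIdeal R)) hle hmap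
  simpa [LinearMap.mem_ker.mp hk] using this

end HomologicalDimension

/-! ### Cohen–Macaulay quotients and height-two primes after localization. -/

section LocalizationAtPrime

open IsLocalRing RingTheory.Sequence

lemma projectiveDimension_quotient_ofList {R : Type u} [CommRing R] [IsLocalRing R]
    [IsNoetherianRing R] (rs : List R) (hrs : IsWeaklyRegular R rs)
    (hm : ∀ r ∈ rs, r ∈ maximalIdeal R) :
    projectiveDimension (ModuleCat.of R (R ⧸ Ideal.ofList rs)) = rs.length := by
  have h := ModuleCat.projectiveDimension_quotient_eq_add_length_of_isWeaklyRegular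
    (ModuleCat.of R R) rs hrs hm
  rw [ModuleCat.projectiveDimension_eq_zero_of_projective (ModuleCat.of R R), zero_add] at h
  rw [← h]
  refine projectiveDimension_eq_of_iso
    (Submodule.quotEquivOfEq (Ideal.ofList rs) (Ideal.ofList rs • ⊤) ?_).toModuleIso
  rw [smul_eq_mul, Ideal.mul_top]

lemma exists_isWeaklyRegular_of_isCohenMacaulayRing {S : Type u} [CommRing S] (I p : Ideal S)
    [p.IsMaximal] (hIp : I ≤ p) (h : IsCohenMacaulayRing (S ⧸ I)) :
    ∃ rs : List (Localization.AtPrime p),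
      (∀ r ∈ rs, r ∈ maximalIdeal (Localization.AtPrime p)) ∧
      IsWeaklyRegular
        (Localization.AtPrime p ⧸ I.map (algebraMap S (Localization.AtPrime p))) rs ∧
      (rs.length : WithBot ℕ∞) = ringKrullDim
        (Localization.AtPrime p ⧸ I.map (algebraMap S (Localization.AtPrime p))) := by
  have hq : ((p.map (Ideal.Quotient.mk I))).IsMaximal :=
    Ideal.IsMaximal.map_of_surjective_of_ker_le Ideal.Quotient.mk_surjective
      (by rwa [Ideal.mk_ker])
  have hpq : p = (p.map (Ideal.Quotient.mk I)).comap (Ideal.Quotient.mk I) := by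
    rw [Ideal.comap_map_of_surjective _ Ideal.Quotient.mk_surjective, ← RingHom.ker_eq_comap_bot,
      Ideal.mk_ker, sup_eq_left.mpr hIp]
  -- Makes `p` literally a preimage of `q`, so that the local homomorphism between the two
  -- localizations can be formed.
  revert hq hpq
  generalize p.map (Ideal.Quotient.mk I) = q
  rintro hq rfl
  obtain ⟨-, rs, hmem, hreg, hlen⟩ := h.2 q
  set f := Localization.localRingHom (q.comap (Ideal.Quotient.mk I)) q (Ideal.Quotient.mk I) rfl
    with hf
  have hsurj : Function.Surjective f := by
    exact RingHom.surjective_localRingHom_of_surjective (Ideal.Quotient.mk I)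
      Ideal.Quotient.mk_surjective q
  have hker : RingHom.ker f = I.map (algebraMap S _) := by
    have := IsLocalization.ker_map (S := Localization.AtPrime (q.comap (Ideal.Quotient.mk I)))
      (Q := Localization.AtPrime q) (g := Ideal.Quotient.mk I)
      (M := (q.comap (Ideal.Quotient.mk I)).primeCompl) (T := q.primeCompl)
      (Submonoid.map_comap_eq_of_surjective Ideal.Quotient.mk_surjective q.primeCompl)
    rw [Ideal.mk_ker] at this
    exact this
  let e := (Ideal.quotEquivOfEq hker.symm).trans (RingHom.quotientKerEquivOfSurjective hsurj)
  have he : ∀ r, e (Ideal.Quotient.mk _ r) = f r := fun r => rfl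
  have hsurj' := hsurj
  choose g hg using hsurj'
  refine ⟨rs.map g, ?_, ?_, ?_⟩
  · intro r hr
    obtain ⟨s, hs, rfl⟩ := List.mem_map.mp hr
    rw [mem_maximalIdeal, mem_nonunits_iff]
    intro hu
    have := hu.map f
    rw [hg] at this
    exact (mem_maximalIdeal _).mp (hmem s hs) this
  · rw [← isWeaklyRegular_map_algebraMap_iff (Localization.AtPrime
      (q.comap (Ideal.Quotient.mk I)) ⧸ I.map (algebraMap S (Localization.AtPrime
        (q.comap (Ideal.Quotient.mk I))))), List.map_map]
    refine (AddEquiv.isWeaklyRegular_congr (e := e.symm.toAddEquiv) ?_).mp hreg.1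
    rw [List.forall₂_map_right_iff, List.forall₂_same]
    intro r _ x
    apply e.injective
    simp [he, hg]
  · rw [List.length_map, hlen]
    exact ringKrullDim_eq_of_ringEquiv e.symm

/-- Let `p` be a prime of a factorial Noetherian domain such that the residue field of the
localization at `p` has projective dimension `N`. For a prime `P ≤ p` of height two, the quotient of
the localization by `P` has dimension at least `N - 2`. -/
lemma le_ringKrullDim_localization_quotient {S : Type u} [CommRing S] [IsDomain S]
    [IsNoetherianRing S] [UniqueFactorizationMonoid S] (p P : Ideal S) [p.IsPrime] [P.IsPrime]
    (hPp : P ≤ p) (hP : P.height = 2) {N : ℕ}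
    (hk : projectiveDimension (ModuleCat.of (Localization.AtPrime p)
      (Localization.AtPrime p ⧸ maximalIdeal (Localization.AtPrime p))) = N) (r : ℕ)
    (hr : r + 2 ≤ N) :
    (r : WithBot ℕ∞) ≤ ringKrullDim
      (Localization.AtPrime p ⧸ P.map (algebraMap S (Localization.AtPrime p))) := by
  have hP0 : P ≠ ⊥ := by
    rintro rfl
    simp at hP
  -- Factoriality provides a prime element `f` of `P`; any `x ∈ P` outside `(f)` completes it to a
  -- regular sequence.
  obtain ⟨f, hfP, hf⟩ := Ideal.IsPrime.exists_mem_prime_of_ne_bot ‹P.IsPrime› hP0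
  have hf' : (Ideal.span {f}).IsPrime := (Ideal.span_singleton_prime hf.ne_zero).mpr hf
  have hfle : Ideal.span {f} ≤ P := (Ideal.span_singleton_le_iff_mem _).mpr hfP
  have hfP' : ¬ P ≤ Ideal.span {f} := by
    intro h
    have := Ideal.height_span_singleton_le_one hf.not_isUnit
    rw [← le_antisymm h hfle, hP] at this
    exact absurd this (by decide)
  obtain ⟨x, hxP, hxf⟩ := Set.not_subset.mp hfP'
  have hreg : IsWeaklyRegular S [f, x] := by
    rw [isWeaklyRegular_cons_iff, isWeaklyRegular_singleton_iff]
    refine ⟨fun a b h => mul_left_cancel₀ hf.ne_zero h, ?_⟩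
    refine (isSMulRegular_quotient_iff_mem_of_smul_mem _ _).mpr fun y hy => ?_
    obtain ⟨z, -, hz⟩ := hy
    have hz : f * z = x * y := hz
    obtain ⟨w, hw⟩ := (hf.dvd_or_dvd (Dvd.intro z hz)).resolve_left fun h =>
      hxf (Ideal.mem_span_singleton.mpr h)
    exact ⟨w, trivial, hw.symm⟩
  -- A smaller prime containing `f` and `x` would give a chain `0 < (f) < Q < P`, too long for
  -- height two.
  have hmin : ∀ Q : Ideal S, Q.IsPrime → Q ≤ P → f ∈ Q → x ∈ Q → Q = P := by
    intro Q hQ hQP hfQ hxQ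
    by_contra hne
    have h1 : (⊥ : Ideal S) < Ideal.span {f} := by
      rw [bot_lt_iff_ne_bot, Ne, Ideal.span_singleton_eq_bot]
      exact hf.ne_zero
    have h2 : Ideal.span {f} < Q := lt_of_le_of_ne
      ((Ideal.span_singleton_le_iff_mem _).mpr hfQ) fun h => hxf (h ▸ hxQ)
    have h3 := Ideal.height_add_one_le_of_lt_of_isPrime (lt_of_le_of_ne hQP hne)
    have h4 := Ideal.height_add_one_le_of_lt_of_isPrime h2
    have h5 := Ideal.height_add_one_le_of_lt_of_isPrime h1
    rw [hP] at h3
    have h6 : (3 : ℕ∞) ≤ 2 := by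
      calc (3 : ℕ∞) = 0 + 1 + 1 + 1 := by norm_num
        _ ≤ (⊥ : Ideal S).height + 1 + 1 + 1 := by gcongr; exact zero_le
        _ ≤ (Ideal.span {f}).height + 1 + 1 := by gcongr
        _ ≤ Q.height + 1 := by gcongr
        _ ≤ 2 := h3
    exact absurd h6 (by decide)
  have hdisj : Disjoint (p.primeCompl : Set S) P :=
    Set.disjoint_left.mpr fun a ha haP => ha (hPp haP)
  have hPR : (P.map (algebraMap S (Localization.AtPrime p))).IsPrime :=
    IsLocalization.isPrime_of_isPrime_disjoint p.primeCompl _ P ‹_› hdisj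
  have hregR := hreg.of_isLocalization (Localization.AtPrime p) p.primeCompl
  have hmemR : ∀ r ∈ [f, x].map (algebraMap S (Localization.AtPrime p)),
      r ∈ P.map (algebraMap S (Localization.AtPrime p)) := by
    simp [Ideal.mem_map_of_mem _ hfP, Ideal.mem_map_of_mem _ hxP]
  have hpd := projectiveDimension_quotient_ofList _ hregR fun r hr =>
    le_maximalIdeal hPR.ne_top (hmemR r hr)
  have hass : IsAssociatedPrime (P.map (algebraMap S (Localization.AtPrime p)))
      (Localization.AtPrime p ⧸
        Ideal.ofList ([f, x].map (algebraMap S (Localization.AtPrime p)))) := by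
    refine Module.associatedPrimes.minimalPrimes_annihilator_subset_associatedPrimes _ _ ?_
    rw [Ideal.annihilator_quotient]
    refine ⟨⟨hPR, Ideal.span_le.mpr hmemR⟩, fun Q hQ hQP => ?_⟩
    have hQp := hQ.1
    have hcomap := hmin (Q.comap (algebraMap S (Localization.AtPrime p))) (hQp.comap _)
      (by
        rw [← IsLocalization.under_map_of_isPrime_disjoint p.primeCompl (Localization.AtPrime p)
          ‹P.IsPrime› hdisj]
        exact Ideal.comap_mono hQP)
      (hQ.2 (Ideal.subset_span (by simp))) (hQ.2 (Ideal.subset_span (by simp)))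
    rw [← hcomap]
    exact Ideal.map_comap_le
  refine le_ringKrullDim_quotient_of_isAssociatedPrime (N := N)
    ((projectiveDimension_le_iff _ _).mp hk.le)
    (fun h => absurd (projectiveDimension_lt_iff.mpr h) (not_lt.mpr hk.ge)) r 2 hr _
    ((projectiveDimension_le_iff _ _).mp hpd.le) hass

end LocalizationAtPrime

/-! ### The polynomial ring at the origin. -/

section PolynomialRing

open IsLocalRing RingTheory.Sequence MvPolynomial

lemma mem_idealOfVars_iff {σ K : Type*} [Field K] {p : MvPolynomial σ K} :
    p ∈ idealOfVars σ K ↔ constantCoeff p = 0 := by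
  have := mem_pow_idealOfVars_iff' (R := K) 1 p
  rw [pow_one] at this
  rw [this]
  simp [constantCoeff_eq, Finsupp.degree_eq_zero_iff]

instance isMaximal_idealOfVars (σ K : Type*) [Field K] : (idealOfVars σ K).IsMaximal := by
  have : idealOfVars σ K = RingHom.ker (constantCoeff (R := K) (σ := σ)) := by
    ext p
    rw [mem_idealOfVars_iff, RingHom.mem_ker]
  rw [this]
  exact RingHom.ker_isMaximal_of_surjective _ fun a => ⟨C a, constantCoeff_C σ a⟩

lemma isWeaklyRegular_map_X (n : ℕ) (K : Type*) [Field K] :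
    IsWeaklyRegular (MvPolynomial (Fin n) K)
      ((List.finRange n).map (X : Fin n → MvPolynomial (Fin n) K)) := by
  refine ⟨fun i hi => ?_⟩
  simp only [List.length_map, List.length_finRange] at hi
  refine (isSMulRegular_quotient_iff_mem_of_smul_mem _ _).mpr fun y hy => ?_
  -- Membership in an ideal generated by variables is tested on monomials, and multiplying by
  -- another variable does not affect the test.
  have hset : {r | r ∈ (List.take i ((List.finRange n).map (X : Fin n → MvPolynomial (Fin n) K)))}
      = X '' {j : Fin n | (j : ℕ) < i} := by
    ext r
    simp only [Set.mem_ofPred_eq, List.mem_take_iff_getElem, List.length_map, List.length_finRange,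
      List.getElem_map, List.getElem_finRange, Set.mem_image]
    constructor
    · rintro ⟨j, hj, rfl⟩
      exact ⟨⟨j, by omega⟩, by simp; omega, by simp⟩
    · rintro ⟨j, hj, rfl⟩
      exact ⟨j, by omega, by simp⟩
  rw [smul_eq_mul, Ideal.mul_top, Ideal.ofList, hset, mem_ideal_span_X_image] at hy ⊢
  intro m hm
  obtain ⟨j, hj, hne⟩ := hy (Finsupp.single ⟨i, hi⟩ 1 + m) (by
    simpa [coeff_X_mul] using hm)
  refine ⟨j, hj, ?_⟩
  have : (⟨i, hi⟩ : Fin n) ≠ j := fun h => by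
    rw [← h] at hj
    simp at hj
  simpa [Finsupp.single_apply, this] using hne

lemma ofList_map_X (n : ℕ) (K : Type*) [Field K] :
    Ideal.ofList ((List.finRange n).map (X : Fin n → MvPolynomial (Fin n) K)) =
      idealOfVars (Fin n) K := by
  rw [Ideal.ofList, idealOfVars]
  congr 1
  ext
  simp

variable {n : ℕ} {K : Type u} [Field K]

lemma projectiveDimension_residueField_localization (n : ℕ) (K : Type u) [Field K] :
    projectiveDimension (ModuleCat.of (Localization.AtPrime (idealOfVars (Fin n) K))
      (Localization.AtPrime (idealOfVars (Fin n) K) ⧸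
        maximalIdeal (Localization.AtPrime (idealOfVars (Fin n) K)))) = n := by
  have hreg := (isWeaklyRegular_map_X n K).of_isLocalization
    (Localization.AtPrime (idealOfVars (Fin n) K)) (idealOfVars (Fin n) K).primeCompl
  have hmax : Ideal.ofList (((List.finRange n).map
      (X : Fin n → MvPolynomial (Fin n) K)).map (algebraMap _ (Localization.AtPrime
        (idealOfVars (Fin n) K)))) = maximalIdeal _ := by
    rw [← Ideal.map_ofList, ofList_map_X, Localization.AtPrime.map_eq_maximalIdeal]
  have := projectiveDimension_quotient_ofList _ hreg
    fun r hr => hmax ▸ Ideal.subset_span hr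
  rw [hmax] at this
  simpa using this

section Height

variable {A : Type*} [CommRing A] {F : A} {I : Ideal A}

/-- Modulo `F`, the image of `P` strictly contains a minimal prime. The preimage of that prime
contains `F ≠ 0`, so it lies strictly between `0` and `P`. -/
lemma two_le_height_of_height_map [IsDomain A] (hF0 : F ≠ 0) (hFI : F ∈ I)
    (hI : (I.map (Ideal.Quotient.mk (Ideal.span {F}))).height = 1) (P : Ideal A) [P.IsPrime]
    (hIP : I ≤ P) : 2 ≤ P.height := by
  set J := P.map (Ideal.Quotient.mk (Ideal.span {F})) with hJ
  have hFP : Ideal.span {F} ≤ P := (Ideal.span_singleton_le_iff_mem _).mpr (hIP hFI)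
  have hJp : J.IsPrime := Ideal.map_isPrime_of_surjective Ideal.Quotient.mk_surjective
    (by rwa [Ideal.mk_ker])
  have h1 : 1 ≤ J.height := hI ▸ Ideal.height_mono (Ideal.map_mono hIP)
  have hnot : J ∉ minimalPrimes (A ⧸ Ideal.span {F}) := fun h => by
    rw [Ideal.height_eq_zero_iff.mpr h] at h1
    exact absurd h1 (by decide)
  obtain ⟨Q, hQ, hQJ⟩ := Ideal.exists_minimalPrimes_le (bot_le : ⊥ ≤ J)
  have hQp := hQ.1.1
  have hlt : Q < J := lt_of_le_of_ne hQJ fun h => hnot (h ▸ hQ)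
  have hlt' : Q.comap (Ideal.Quotient.mk (Ideal.span {F})) < P := by
    have hJP : J.comap (Ideal.Quotient.mk (Ideal.span {F})) = P := by
      rw [hJ, Ideal.comap_map_of_surjective _ Ideal.Quotient.mk_surjective,
        ← RingHom.ker_eq_comap_bot, Ideal.mk_ker, sup_eq_left.mpr hFP]
    refine lt_of_le_of_ne (hJP ▸ Ideal.comap_mono hQJ) fun h => hlt.ne ?_
    rw [hJ, ← h, Ideal.map_comap_of_surjective _ Ideal.Quotient.mk_surjective]
  have hbot : (⊥ : Ideal A) < Q.comap (Ideal.Quotient.mk (Ideal.span {F})) := by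
    rw [bot_lt_iff_ne_bot]
    intro h
    apply hF0
    rw [← Ideal.mem_bot, ← h, Ideal.mem_comap,
      Ideal.Quotient.eq_zero_iff_mem.mpr (Ideal.mem_span_singleton_self F)]
    exact Q.zero_mem
  have h2 := Ideal.height_add_one_le_of_lt_of_isPrime hbot
  have h3 := Ideal.height_add_one_le_of_lt_of_isPrime hlt'
  calc (2 : ℕ∞) = 0 + 1 + 1 := by norm_num
    _ ≤ (⊥ : Ideal A).height + 1 + 1 := by gcongr; exact zero_le
    _ ≤ _ := by gcongr
    _ ≤ _ := h3

/-- By Krull's principal ideal theorem, dividing by `F` lowers the height by at most one. -/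
lemma exists_isPrime_height_le_two [IsNoetherianRing A] (hFI : F ∈ I)
    (hI : (I.map (Ideal.Quotient.mk (Ideal.span {F}))).height = 1) :
    ∃ P : Ideal A, P.IsPrime ∧ I ≤ P ∧ P.height ≤ 2 := by
  obtain ⟨J, hJ, hIJ, hJ1⟩ := Ideal.exists_isPrime_height_eq (n := 1) hI
  have hle : I ≤ J.comap (Ideal.Quotient.mk (Ideal.span {F})) := Ideal.map_le_iff_le_comap.mp hIJ
  refine ⟨J.comap (Ideal.Quotient.mk (Ideal.span {F})), hJ.comap _, hle, ?_⟩
  refine (Ideal.height_le_height_add_one_of_mem (hle hFI)).trans ?_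
  rw [Ideal.map_comap_of_surjective _ Ideal.Quotient.mk_surjective, hJ1]
  norm_num

lemma height_eq_two_of_height_map [IsDomain A] [IsNoetherianRing A] (hF0 : F ≠ 0) (hFI : F ∈ I)
    (hI : (I.map (Ideal.Quotient.mk (Ideal.span {F}))).height = 1) : I.height = 2 := by
  refine le_antisymm ?_ ?_
  · obtain ⟨P, hP, hIP, hP2⟩ := exists_isPrime_height_le_two hFI hI
    exact (Ideal.height_mono hIP).trans hP2
  · rw [Ideal.height_eq_inf_minimalPrimes]
    refine le_iInf₂ fun J hJ => ?_
    have := hJ.1.1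
    exact two_le_height_of_height_map hF0 hFI hI J hJ.1.2

end Height

lemma le_idealOfVars_of_isHomogeneous {P : Ideal (MvPolynomial (Fin n) K)}
    (hP : P.IsHomogeneous (homogeneousSubmodule (Fin n) K)) (hP1 : P ≠ ⊤) :
    P ≤ idealOfVars (Fin n) K := by
  intro p hp
  rw [mem_idealOfVars_iff]
  by_contra h
  apply hP1
  have h0 := hP 0 hp
  have h1 : (DirectSum.decompose (homogeneousSubmodule (Fin n) K) p 0 : MvPolynomial (Fin n) K) =
      homogeneousComponent 0 p := decomposition.decompose'_apply p 0
  rw [h1, homogeneousComponent_zero] at h0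
  exact Ideal.eq_top_of_isUnit_mem _ h0 ((isUnit_iff_ne_zero.mpr h).map C)

/-- The homogeneous coordinate ring of an arithmetically Cohen--Macaulay subscheme of codimension
two has projective dimension at most two at the origin. -/
lemma hasProjectiveDimensionLE_two_localization {F : MvPolynomial (Fin (n + 1)) K}
    {I : Ideal (MvPolynomial (Fin (n + 1)) K)}
    (hIh : I.IsHomogeneous (homogeneousSubmodule (Fin (n + 1)) K)) (hF0 : F ≠ 0) (hFI : F ∈ I)
    (hI : (I.map (Ideal.Quotient.mk (Ideal.span {F}))).height = 1)
    (hCM : IsCohenMacaulayRing (MvPolynomial (Fin (n + 1)) K ⧸ I)) :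
    HasProjectiveDimensionLE (ModuleCat.of
      (Localization.AtPrime (idealOfVars (Fin (n + 1)) K))
      (Localization.AtPrime (idealOfVars (Fin (n + 1)) K) ⧸
        I.map (algebraMap _ (Localization.AtPrime (idealOfVars (Fin (n + 1)) K))))) 2 := by
  obtain ⟨P₀, hP₀, hIP₀, hP₀2⟩ := exists_isPrime_height_le_two hFI hI
  -- `P₀` need not lie in the ideal of the origin. Its homogeneous core does, and it is still a
  -- prime containing `I`, of height two.
  set P := (P₀.homogeneousCore (homogeneousSubmodule (Fin (n + 1)) K)).toIdeal with hPdef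
  have hP : P.IsPrime := hP₀.homogeneousCore
  have hIP : I ≤ P := by
    rw [← hIh.toIdeal_homogeneousCore_eq_self]
    exact Ideal.homogeneousCore_mono _ hIP₀
  have hP2 : P.height = 2 := le_antisymm
    ((Ideal.height_mono (Ideal.toIdeal_homogeneousCore_le _ _)).trans hP₀2)
    (two_le_height_of_height_map hF0 hFI hI P hIP)
  have hPm : P ≤ idealOfVars (Fin (n + 1)) K :=
    le_idealOfVars_of_isHomogeneous (HomogeneousIdeal.isHomogeneous _) hP.ne_top
  have hk := projectiveDimension_residueField_localization (n + 1) K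
  obtain ⟨rs, hmem, hreg, hlen⟩ := exists_isWeaklyRegular_of_isCohenMacaulayRing I
    (idealOfVars (Fin (n + 1)) K) (hIP.trans hPm) hCM
  have hmapne : I.map (algebraMap _ (Localization.AtPrime (idealOfVars (Fin (n + 1)) K))) ≠ ⊤ := by
    refine ne_top_of_le_ne_top (maximalIdeal.isMaximal _).ne_top (?_ : _ ≤ maximalIdeal _)
    rw [← Localization.AtPrime.map_eq_maximalIdeal]
    exact Ideal.map_mono (hIP.trans hPm)
  have := Ideal.Quotient.nontrivial_iff.mpr hmapne
  refine hasProjectiveDimensionLE_of_isWeaklyRegular ((projectiveDimension_le_iff _ _).mp hk.le)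
    _ rs hreg hmem 2 ?_
  -- With a single variable `N = 1`, and the bound two is automatic. Otherwise `N = n + 2` in the
  -- new `n`.
  rcases n with - | n
  · omega
  have hdim := le_ringKrullDim_localization_quotient (idealOfVars (Fin (n + 1 + 1)) K) P hPm hP2
    hk n le_rfl
  have hmono := Ideal.map_mono
    (f := algebraMap _ (Localization.AtPrime (idealOfVars (Fin (n + 1 + 1)) K))) hIP
  have hle : ringKrullDim (_ ⧸ P.map (algebraMap _ (Localization.AtPrime
      (idealOfVars (Fin (n + 1 + 1)) K)))) ≤ ringKrullDim (_ ⧸ I.map (algebraMap _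
      (Localization.AtPrime (idealOfVars (Fin (n + 1 + 1)) K)))) :=
    ringKrullDim_le_of_surjective (Ideal.Quotient.factor hmono)
      (Ideal.Quotient.factor_surjective hmono)
  have h := (hdim.trans hle).trans hlen.ge
  have h : n ≤ rs.length := by exact_mod_cast h
  omega

end PolynomialRing

/-! ### Homogeneous generators of syzygies. -/

section GradedSyzygies

open IsLocalRing MvPolynomial

/-- A generating set contains an irredundant finite generating family, relative to a submodule. -/
lemma exists_irredundant_family {R M : Type*} [Ring R] [AddCommGroup M] [Module R M] (T : Set M)
    (hT : (Submodule.span R T).FG) (N : Submodule R M) :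
    ∃ (t : ℕ) (g : Fin t → M), (∀ j, g j ∈ T) ∧
      Submodule.span R (Set.range g) ⊔ N = Submodule.span R T ⊔ N ∧
      ∀ j, g j ∉ Submodule.span R (g '' {j}ᶜ) ⊔ N := by
  classical
  have hex : ∃ (t : ℕ) (g : Fin t → M), (∀ j, g j ∈ T) ∧
      Submodule.span R (Set.range g) ⊔ N = Submodule.span R T ⊔ N := by
    obtain ⟨s, hs, hspan⟩ := (Submodule.fg_span_iff_fg_span_finset_subset T).mp hT
    refine ⟨s.card, fun j => s.equivFin.symm j, fun j => hs (s.equivFin.symm j).2, ?_⟩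
    rw [hspan]
    congr 2
    ext x
    constructor
    · rintro ⟨j, rfl⟩
      exact (s.equivFin.symm j).2
    · intro hx
      exact ⟨s.equivFin ⟨x, hx⟩, by simp⟩
  -- A family of least size is irredundant, since a redundant member could be dropped.
  obtain ⟨g, hg, hspan⟩ := Nat.find_spec hex
  refine ⟨Nat.find hex, g, hg, hspan, fun j hj => ?_⟩
  revert g hspan j
  have hmin := fun k => Nat.find_min hex (m := k)
  revert hmin
  generalize Nat.find hex = t
  rcases t with - | t
  · intro _ _ _ _ j
    exact j.elim0
  intro hmin g hg hspan j hj
  refine hmin t (Nat.lt_succ_self t) ⟨g ∘ j.succAbove, fun k => hg _, ?_⟩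
  have hrange : Set.range (g ∘ j.succAbove) = g '' {j}ᶜ := by
    rw [Set.range_comp, Fin.range_succAbove]
  rw [hrange, ← hspan]
  refine le_antisymm (sup_le_sup_right (Submodule.span_mono (Set.image_subset_range _ _)) _)
    (sup_le (Submodule.span_le.mpr ?_) le_sup_right)
  rintro _ ⟨k, rfl⟩
  by_cases hk : k = j
  · rw [hk]
    exact hj
  · exact Submodule.mem_sup_left (Submodule.subset_span ⟨k, hk, rfl⟩)

variable {σ K : Type*} [CommRing K]

lemma homogeneousComponent_mul_of_isHomogeneous {g : MvPolynomial σ K} {e : ℕ}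
    (hg : g.IsHomogeneous e) (p : MvPolynomial σ K) (D : ℕ) :
    homogeneousComponent D (p * g) =
      if e ≤ D then homogeneousComponent (D - e) p * g else 0 := by
  conv_lhs => rw [← sum_homogeneousComponent p, Finset.sum_mul, map_sum]
  have hterm : ∀ k, homogeneousComponent D (homogeneousComponent k p * g) =
      if D = k + e then homogeneousComponent k p * g else 0 := fun k =>
    homogeneousComponent_of_mem
      (((homogeneousComponent_isHomogeneous k p).mul hg : IsHomogeneous _ _))
  simp only [hterm]
  split_ifs with h
  · rw [Finset.sum_eq_single (D - e)]
    · rw [if_pos (by omega)]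
    · intro k _ hk
      rw [if_neg (by omega)]
    · intro hk
      rw [if_pos (by omega), homogeneousComponent_eq_zero, zero_mul]
      rw [Finset.mem_range] at hk
      omega
  · exact Finset.sum_eq_zero fun k _ => if_neg (by omega)

variable {ι : Type*}

/-- The degree `D` part of a vector of polynomials, where the `i`-th basis vector is placed in
degree `e i`. -/
noncomputable def vectorComponent (e : ι → ℕ) (D : ℕ) :
    (ι → MvPolynomial σ K) →ₗ[K] (ι → MvPolynomial σ K) :=
  LinearMap.pi fun i =>
    if e i ≤ D then homogeneousComponent (D - e i) ∘ₗ LinearMap.proj i else 0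

/-- A vector of polynomials is homogeneous of degree `D` if its `i`-th entry is homogeneous of degree
`D - e i`, and zero if `D < e i`. -/
def IsHomogeneousVector (e : ι → ℕ) (D : ℕ) (v : ι → MvPolynomial σ K) : Prop :=
  ∀ i, (e i ≤ D → (v i).IsHomogeneous (D - e i)) ∧ (D < e i → v i = 0)

lemma vectorComponent_apply (e : ι → ℕ) (D : ℕ) (v : ι → MvPolynomial σ K) (i : ι) :
    vectorComponent e D v i = if e i ≤ D then homogeneousComponent (D - e i) (v i) else 0 := by
  simp only [vectorComponent, LinearMap.pi_apply]
  split_ifs <;> rfl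

lemma isHomogeneousVector_vectorComponent (e : ι → ℕ) (D : ℕ) (v : ι → MvPolynomial σ K) :
    IsHomogeneousVector e D (vectorComponent e D v) := by
  intro i
  rw [vectorComponent_apply]
  refine ⟨fun h => ?_, fun h => if_neg (by omega)⟩
  rw [if_pos h]
  exact homogeneousComponent_isHomogeneous _ _

lemma exists_sum_vectorComponent [Finite ι] (e : ι → ℕ) (v : ι → MvPolynomial σ K) :
    ∃ B : ℕ, v = ∑ D ∈ Finset.range B, vectorComponent e D v := by
  have := Fintype.ofFinite ι
  refine ⟨∑ i, (e i + (v i).totalDegree + 1), funext fun i => ?_⟩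
  have hle : e i + (v i).totalDegree + 1 ≤ ∑ i, (e i + (v i).totalDegree + 1) :=
    Finset.single_le_sum (f := fun i => e i + (v i).totalDegree + 1)
      (fun _ _ => Nat.zero_le _) (Finset.mem_univ i)
  generalize ∑ i, (e i + (v i).totalDegree + 1) = B at hle
  obtain ⟨C, rfl⟩ := Nat.exists_eq_add_of_le hle
  rw [Finset.sum_apply]
  simp only [vectorComponent_apply]
  rw [add_assoc (e i), add_assoc (e i), Finset.sum_range_add, Finset.sum_eq_zero, zero_add,
    Finset.sum_range_add]
  · conv_lhs => rw [← sum_homogeneousComponent (v i)]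
    rw [Finset.sum_eq_zero (s := Finset.range C), add_zero]
    · refine Finset.sum_congr rfl fun k _ => ?_
      rw [if_pos (by omega), Nat.add_sub_cancel_left]
    · intro k _
      rw [if_pos (by omega), Nat.add_sub_cancel_left, homogeneousComponent_eq_zero]
      omega
  · intro k hk
    rw [if_neg]
    have := Finset.mem_range.mp hk
    omega

lemma vectorComponent_smul {e : ι → ℕ} {D' : ℕ} {z : ι → MvPolynomial σ K}
    (hz : IsHomogeneousVector e D' z) (c : MvPolynomial σ K) (D : ℕ) :
    vectorComponent e D (c • z) =
      if D' ≤ D then homogeneousComponent (D - D') c • z else 0 := by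
  funext i
  rw [vectorComponent_apply, Pi.smul_apply, smul_eq_mul]
  rcases lt_or_ge D' (e i) with h | h
  · have h0 := (hz i).2 h
    rw [h0, mul_zero, map_zero]
    split_ifs <;> simp [h0]
  · rw [homogeneousComponent_mul_of_isHomogeneous ((hz i).1 h)]
    by_cases hD : D' ≤ D
    · rw [if_pos (by omega), if_pos (by omega), if_pos hD, Pi.smul_apply, smul_eq_mul]
      congr 3
      omega
    · rw [if_neg hD]
      split_ifs with h1 h2
      · have : D - e i - (D' - e i) = 0 := by omega
        omega
      · rfl
      · rfl

variable [Fintype ι]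

lemma linearCombination_vectorComponent {G : ι → MvPolynomial σ K} {e : ι → ℕ}
    (hG : ∀ i, (G i).IsHomogeneous (e i)) (D : ℕ) (v : ι → MvPolynomial σ K) :
    Fintype.linearCombination (MvPolynomial σ K) G (vectorComponent e D v) =
      homogeneousComponent D (Fintype.linearCombination (MvPolynomial σ K) G v) := by
  simp only [Fintype.linearCombination_apply, smul_eq_mul, map_sum]
  refine Finset.sum_congr rfl fun i _ => ?_
  rw [homogeneousComponent_mul_of_isHomogeneous (hG i), vectorComponent_apply, ite_mul, zero_mul]

/-- The syzygies of homogeneous polynomials are generated by the homogeneous syzygies. -/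
lemma span_homogeneous_ker {G : ι → MvPolynomial σ K} {e : ι → ℕ}
    (hG : ∀ i, (G i).IsHomogeneous (e i)) :
    Submodule.span (MvPolynomial σ K) {v | v ∈ LinearMap.ker
        (Fintype.linearCombination (MvPolynomial σ K) G) ∧ ∃ D, IsHomogeneousVector e D v} =
      LinearMap.ker (Fintype.linearCombination (MvPolynomial σ K) G) := by
  refine le_antisymm (Submodule.span_le.mpr fun v hv => hv.1) fun v hv => ?_
  obtain ⟨B, hB⟩ := exists_sum_vectorComponent e v
  rw [hB]
  refine Submodule.sum_mem _ fun D _ => Submodule.subset_span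
    ⟨?_, D, isHomogeneousVector_vectorComponent e D v⟩
  rw [LinearMap.mem_ker, linearCombination_vectorComponent hG, LinearMap.mem_ker.mp hv, map_zero]

omit [Fintype ι] in
/-- The coefficients of a relation between irredundant homogeneous vectors have no constant term. -/
lemma constantCoeff_eq_zero_of_sum_smul_eq_zero {K : Type*} [Field K] {κ : Type*} [Fintype κ]
    {e : ι → ℕ} {z : κ → ι → MvPolynomial σ K} {D : κ → ℕ}
    (hz : ∀ j, IsHomogeneousVector e (D j) (z j)) {j : κ}
    (hj : z j ∉ Submodule.span (MvPolynomial σ K) (z '' {j}ᶜ)) {c : κ → MvPolynomial σ K}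
    (hc : ∑ k, c k • z k = 0) : constantCoeff (c j) = 0 := by
  classical
  by_contra h0
  apply hj
  -- In degree `D j` the coefficient of `z j` contributes only its constant term, which if nonzero
  -- can be inverted to express `z j` by the others.
  have h := congrArg (vectorComponent e (D j)) hc
  rw [map_zero, map_sum, ← Finset.add_sum_erase _ _ (Finset.mem_univ j),
    vectorComponent_smul (hz j), if_pos le_rfl, Nat.sub_self, homogeneousComponent_zero] at h
  have hmem : C (σ := σ) (coeff 0 (c j)) • z j ∈ Submodule.span (MvPolynomial σ K) (z '' {j}ᶜ) := by
    rw [eq_neg_of_add_eq_zero_left h]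
    refine Submodule.neg_mem _ (Submodule.sum_mem _ fun k hk => ?_)
    rw [vectorComponent_smul (hz k)]
    split_ifs
    · exact Submodule.smul_mem _ _
        (Submodule.subset_span ⟨k, Finset.ne_of_mem_erase hk, rfl⟩)
    · exact Submodule.zero_mem _
  have := Submodule.smul_mem _ (C (σ := σ) (coeff 0 (c j))⁻¹) hmem
  rwa [smul_smul, ← C_mul, inv_mul_cancel₀ (by rwa [← constantCoeff_eq]), C_1, one_smul] at this

end GradedSyzygies

/-! ### Independence and number of minimal syzygies. -/

section SyzygyBasis

open IsLocalRing MvPolynomial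

/-- Clearing denominators in a localization at a prime. -/
lemma exists_smul_eq_algebraMap {S R : Type*} [CommRing S] [CommRing R] [Algebra S R] (p : Ideal S)
    [p.IsPrime] [IsLocalization.AtPrime R p] {ι : Type*} [Finite ι] (v : ι → R) :
    ∃ u : Rˣ, ∃ w : ι → S, ∀ i, algebraMap S R (w i) = u * v i := by
  obtain ⟨b, hb⟩ := IsLocalization.exist_integer_multiples_of_finite p.primeCompl v
  choose w hw using hb
  refine ⟨(IsLocalization.map_units R b).unit, w, fun i => ?_⟩
  rw [hw, Algebra.smul_def]
  rfl

/-- Generators of the syzygies of an ideal which are minimal at a prime `p` of a domain are linearly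
independent if the quotient by the ideal has projective dimension at most two at `p`. -/
lemma linearIndependent_of_minimal {S R : Type u} [CommRing S] [IsDomain S] [CommRing R]
    [Algebra S R] (p : Ideal S) [p.IsPrime] [IsLocalization.AtPrime R p] [IsLocalRing R]
    [IsNoetherianRing R] {ι : Type} [Fintype ι] {G : ι → S}
    (hpd : HasProjectiveDimensionLE (ModuleCat.of R
      (R ⧸ (Ideal.span (Set.range G)).map (algebraMap S R))) 2)
    {s : ℕ} {z : Fin s → ι → S}
    (hspan : Submodule.span S (Set.range z) = LinearMap.ker (Fintype.linearCombination S G))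
    (hmin : ∀ c : Fin s → S, ∑ j, c j • z j = 0 → ∀ j, c j ∈ p) :
    LinearIndependent S z := by
  have hinj : Function.Injective (algebraMap S R) :=
    IsLocalization.injective _ p.primeCompl_le_nonZeroDivisors
  set φ := Fintype.linearCombination R (fun i => algebraMap S R (G i)) with hφ
  have hrange : LinearMap.range φ = (Ideal.span (Set.range G)).map (algebraMap S R) := by
    rw [hφ, Fintype.range_linearCombination, Ideal.map_span, ← Set.range_comp]
    rfl
  have hproj : Module.Projective R (LinearMap.ker φ) :=
    projective_ker_of_hasProjectiveDimensionLE_two φ (by rw [hrange]; exact hpd)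
  have hφα : ∀ w : ι → S, φ (fun i => algebraMap S R (w i)) =
      algebraMap S R (Fintype.linearCombination S G w) := by
    intro w
    simp [hφ, Fintype.linearCombination_apply]
  have hzmem : ∀ j, (fun i => algebraMap S R (z j i)) ∈ LinearMap.ker φ := by
    intro j
    have : z j ∈ LinearMap.ker (Fintype.linearCombination S G) :=
      hspan ▸ Submodule.subset_span ⟨j, rfl⟩
    rw [LinearMap.mem_ker, hφα, LinearMap.mem_ker.mp this, map_zero]
  -- `ψ` is surjective because the `z j` generate the syzygies after clearing denominators. Its
  -- kernel lies in `m` times the free module by minimality, so projectivity of the target makes it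
  -- injective.
  set ψ := Fintype.linearCombination R
    (fun j => (⟨fun i => algebraMap S R (z j i), hzmem j⟩ : LinearMap.ker φ)) with hψ
  have hψapply : ∀ c i, (ψ c : ι → R) i = ∑ j, c j * algebraMap S R (z j i) := by
    intro c i
    simp [hψ, Fintype.linearCombination_apply, Finset.sum_apply]
  have hψα : ∀ c : Fin s → S, ∀ i,
      (ψ (fun j => algebraMap S R (c j)) : ι → R) i = algebraMap S R ((∑ j, c j • z j) i) := by
    intro c i
    simp [hψapply, Finset.sum_apply]
  have hsurj : Function.Surjective ψ := by
    rintro ⟨v, hv⟩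
    obtain ⟨u, w, hw⟩ := exists_smul_eq_algebraMap p v
    have hw' : (fun i => algebraMap S R (w i)) = (u : R) • v := funext hw
    have hwker : w ∈ LinearMap.ker (Fintype.linearCombination S G) := by
      refine LinearMap.mem_ker.mpr (hinj ?_)
      rw [← hφα, hw', map_smul, LinearMap.mem_ker.mp hv, smul_zero, map_zero]
    rw [← hspan, ← Fintype.range_linearCombination] at hwker
    obtain ⟨c, hc⟩ := hwker
    rw [Fintype.linearCombination_apply] at hc
    refine ⟨(↑u⁻¹ : R) • fun j => algebraMap S R (c j), Subtype.ext (funext fun i => ?_)⟩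
    rw [map_smul, Submodule.coe_smul, Pi.smul_apply, hψα, hc, hw i, smul_eq_mul,
      Units.inv_mul_cancel_left]
  have hker : LinearMap.ker ψ ≤ maximalIdeal R • ⊤ := by
    intro c hc
    obtain ⟨u, w, hw⟩ := exists_smul_eq_algebraMap p c
    have hw' : (fun i => algebraMap S R (w i)) = (u : R) • c := funext hw
    have hsum : ∑ j, w j • z j = 0 := by
      funext i
      apply hinj
      rw [← hψα, hw', map_smul, LinearMap.mem_ker.mp hc]
      simp
    rw [pi_eq_sum_univ c]
    refine Submodule.sum_mem _ fun j _ => Submodule.smul_mem_smul ?_ trivial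
    have hj : c j = (↑u⁻¹ : R) * algebraMap S R (w j) := by
      rw [hw j, Units.inv_mul_cancel_left]
    rw [hj, ← IsLocalization.AtPrime.map_eq_maximalIdeal p R]
    exact Ideal.mul_mem_left _ _ (Ideal.mem_map_of_mem _ (hmin w hsum j))
  have hψinj := injective_of_projective_of_ker_le ψ hsurj hker
  rw [Fintype.linearIndependent_iff]
  intro c hc j
  have : ψ (fun j => algebraMap S R (c j)) = 0 := Subtype.ext (funext fun i => by
    rw [hψα, hc]
    simp)
  have := congrFun ((map_eq_zero_iff ψ hψinj).mp this) j
  exact (map_eq_zero_iff (algebraMap S R) hinj).mp this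

/-- A basis of the syzygies of `t + 1` elements of a domain, the first of which is nonzero, has
`t` elements. -/
lemma eq_of_span_eq_ker_linearCombination {S : Type*} [CommRing S] [IsDomain S] {t s : ℕ}
    {G : Fin (t + 1) → S} (hG : G 0 ≠ 0) {z : Fin s → Fin (t + 1) → S}
    (hz : LinearIndependent S z)
    (hspan : Submodule.span S (Set.range z) = LinearMap.ker (Fintype.linearCombination S G)) :
    s = t := by
  have hzmem : ∀ c : Fin s → S, ∑ i, (∑ j, c j • z j) i * G i = 0 := by
    intro c
    have : ∑ j, c j • z j ∈ LinearMap.ker (Fintype.linearCombination S G) := by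
      rw [← hspan]
      exact Submodule.sum_mem _ fun j _ => Submodule.smul_mem _ _ (Submodule.subset_span ⟨j, rfl⟩)
    simpa only [LinearMap.mem_ker, Fintype.linearCombination_apply, smul_eq_mul] using this
  refine le_antisymm ?_ ?_
  -- A syzygy is determined by its entries beyond the first, because `G 0 ≠ 0`.
  · refine le_of_fin_injective S
      ((LinearMap.funLeft S S Fin.succ) ∘ₗ Fintype.linearCombination S z) ?_
    rw [← LinearMap.ker_eq_bot, LinearMap.ker_eq_bot']
    intro c hc
    have h0 : ∑ j, c j • z j = 0 := by
      have hsucc : ∀ i : Fin t, (∑ j, c j • z j) i.succ = 0 := fun i => congrFun hc i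
      have h := hzmem c
      rw [Fin.sum_univ_succ] at h
      simp only [hsucc, zero_mul, Finset.sum_const_zero, add_zero] at h
      funext i
      refine Fin.cases ?_ hsucc i
      exact (mul_eq_zero.mp h).resolve_right hG
    funext j
    exact Fintype.linearIndependent_iff.mp hz c h0 j
  -- The Koszul relations between `G 0` and the other `G i` embed a free module of rank `t` into the
  -- syzygies.
  · let χ : (Fin t → S) →ₗ[S] (Fin (t + 1) → S) :=
      LinearMap.pi (Fin.cases (-Fintype.linearCombination S (fun i : Fin t => G i.succ))
        fun i => G 0 • LinearMap.proj i)
    have hχ : ∀ v, χ v ∈ Submodule.span S (Set.range z) := by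
      intro v
      rw [hspan, LinearMap.mem_ker, Fintype.linearCombination_apply, Fin.sum_univ_succ]
      simp only [χ, LinearMap.pi_apply, Fin.cases_zero, Fin.cases_succ, LinearMap.neg_apply,
        Fintype.linearCombination_apply, LinearMap.smul_apply, LinearMap.proj_apply, smul_eq_mul,
        neg_mul, Finset.sum_mul]
      rw [neg_add_eq_zero]
      exact Finset.sum_congr rfl fun i _ => by ring
    refine le_of_fin_injective S ((Module.Basis.span hz).equivFun.toLinearMap ∘ₗ
      χ.codRestrict _ hχ) ?_
    rw [LinearMap.coe_comp]
    refine (LinearEquiv.injective _).comp ?_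
    intro v w h
    have h : χ v = χ w := congrArg Subtype.val h
    funext i
    have hi := congrFun h i.succ
    simp only [χ, LinearMap.pi_apply, Fin.cases_succ, LinearMap.smul_apply, LinearMap.proj_apply,
      smul_eq_mul] at hi
    exact mul_left_cancel₀ hG hi

end SyzygyBasis

/-! ### Hilbert–Burch and determinants of graded matrices. -/

section Determinant

open MvPolynomial Matrix

/-- The determinant obtained from a basis `z` of the syzygies of `G` by completing with a vector `c`
is not divisible by a prime which does not divide the combination of `G` with coefficients `c`. -/
lemma not_dvd_det_cons {S : Type*} [CommRing S] [IsDomain S] {t : ℕ} {G : Fin (t + 1) → S}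
    {z : Fin t → Fin (t + 1) → S} (hz : LinearIndependent S z)
    (hspan : Submodule.span S (Set.range z) = LinearMap.ker (Fintype.linearCombination S G))
    {p : S} (hp : Prime p) (c : Fin (t + 1) → S) (hc : ¬ p ∣ c ⬝ᵥ G) :
    ¬ p ∣ (Matrix.of fun i j => (Fin.cons c z : Fin (t + 1) → Fin (t + 1) → S) j i).det := by
  intro hdvd
  have hpp : (Ideal.span {p}).IsPrime := (Ideal.span_singleton_prime hp.ne_zero).mpr hp
  have hdet : ((Ideal.Quotient.mk (Ideal.span {p})).mapMatrix
      (Matrix.of fun i j => (Fin.cons c z : Fin (t + 1) → Fin (t + 1) → S) j i)).det = 0 := by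
    rw [← RingHom.map_det, Ideal.Quotient.eq_zero_iff_mem, Ideal.mem_span_singleton]
    exact hdvd
  -- Over the domain `S/(p)` the singular matrix kills some `v ≠ 0`. Its lift `w` satisfies `w 0 • c
  -- + ∑ w (j+1) • z j = p • q`. Pairing with `G` gives `p ∣ w 0`; then `q - w' • c` is a syzygy,
  -- and independence of `z` makes `p` divide every `w i`, so `v = 0`.
  obtain ⟨v, hv0, hv⟩ := Matrix.exists_mulVec_eq_zero_iff.mpr hdet
  choose w hw using fun i => Ideal.Quotient.mk_surjective (v i)
  have hdvdi : ∀ i, p ∣ w 0 * c i + ∑ j, w (Fin.succ j) * z j i := by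
    intro i
    rw [← Ideal.mem_span_singleton, ← Ideal.Quotient.eq_zero_iff_mem]
    have := congrFun hv i
    simp only [Matrix.mulVec, dotProduct, Fin.sum_univ_succ, RingHom.mapMatrix_apply, map_apply,
      of_apply, Fin.cons_zero, Fin.cons_succ, ← hw, Pi.zero_apply] at this
    simpa [mul_comm] using this
  choose q hq using hdvdi
  have hzG : ∀ j, ∑ i, z j i * G i = 0 := fun j => by
    have : z j ∈ LinearMap.ker (Fintype.linearCombination S G) :=
      hspan ▸ Submodule.subset_span ⟨j, rfl⟩
    simpa only [LinearMap.mem_ker, Fintype.linearCombination_apply, smul_eq_mul] using this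
  have hw0 : w 0 * (c ⬝ᵥ G) = p * (q ⬝ᵥ G) := by
    have h : ∑ i, (w 0 * c i + ∑ j, w (Fin.succ j) * z j i) * G i = ∑ i, (p * q i) * G i :=
      Finset.sum_congr rfl fun i _ => by rw [hq]
    simp only [add_mul, Finset.sum_add_distrib, Finset.sum_mul] at h
    rw [Finset.sum_comm] at h
    simp only [mul_assoc, ← Finset.mul_sum, hzG, mul_zero, Finset.sum_const_zero, add_zero] at h
    exact h
  obtain ⟨w', hw'⟩ := (hp.dvd_or_dvd (Dvd.intro _ hw0.symm)).resolve_right hc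
  have hker : q - w' • c ∈ LinearMap.ker (Fintype.linearCombination S G) := by
    rw [LinearMap.mem_ker, Fintype.linearCombination_apply]
    apply mul_left_cancel₀ hp.ne_zero
    have h1 : p * (w' * (c ⬝ᵥ G)) = p * (q ⬝ᵥ G) := by rw [← hw0, hw', mul_assoc]
    have h2 : ∑ i, (q - w' • c) i • G i = q ⬝ᵥ G - w' * (c ⬝ᵥ G) := by
      simp only [dotProduct, Pi.sub_apply, Pi.smul_apply, smul_eq_mul, sub_mul, mul_assoc,
        Finset.sum_sub_distrib, Finset.mul_sum]
    rw [h2, mul_sub, h1, sub_self, mul_zero]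
  rw [← hspan, ← Fintype.range_linearCombination] at hker
  obtain ⟨e, he⟩ := hker
  rw [Fintype.linearCombination_apply] at he
  have hsum : ∑ j, (w (Fin.succ j) - p * e j) • z j = 0 := by
    funext i
    have h1 := congrFun he i
    have h2 := hq i
    rw [hw', mul_assoc] at h2
    simp only [Finset.sum_apply, Pi.smul_apply, smul_eq_mul, Pi.sub_apply] at h1
    simp only [Finset.sum_apply, Pi.smul_apply, smul_eq_mul, sub_mul, Finset.sum_sub_distrib,
      mul_assoc, ← Finset.mul_sum, h1, Pi.zero_apply]
    linear_combination h2
  apply hv0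
  funext i
  rw [← hw i, Pi.zero_apply, Ideal.Quotient.eq_zero_iff_mem, Ideal.mem_span_singleton]
  refine Fin.cases ?_ (fun j => ?_) i
  · exact ⟨w', hw'⟩
  · exact ⟨e j, sub_eq_zero.mp (Fintype.linearIndependent_iff.mp hz _ hsum j)⟩

/-- Cramer's rule: the row vector `G` times the completed matrix is `(c ⬝ᵥ G, 0, …, 0)`. Multiplying
by the adjugate leaves a single cofactor. -/
lemma mul_det_cons_eq {S : Type*} [CommRing S] {t : ℕ} {G : Fin (t + 1) → S}
    {z : Fin t → Fin (t + 1) → S} (hz : ∀ j, z j ⬝ᵥ G = 0) (c : Fin (t + 1) → S) :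
    G 0 * (Matrix.of fun i j => (Fin.cons c z : Fin (t + 1) → Fin (t + 1) → S) j i).det =
      (c ⬝ᵥ G) * (Matrix.of fun i j => z j (Fin.succ i)).det := by
  set B := Matrix.of fun i j => (Fin.cons c z : Fin (t + 1) → Fin (t + 1) → S) j i with hB
  have hGB : G ᵥ* B = Pi.single 0 (c ⬝ᵥ G) := by
    funext j
    refine Fin.cases ?_ (fun j => ?_) j
    · simp [hB, vecMul, dotProduct_comm]
    · have : (G ᵥ* B) j.succ = z j ⬝ᵥ G := dotProduct_comm _ _
      rw [this, hz, Pi.single_eq_of_ne (Fin.succ_ne_zero j)]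
  have h := congrFun (congrArg (fun v => v ᵥ* B.adjugate) hGB) 0
  simp only [vecMul_vecMul, mul_adjugate, vecMul_smul, vecMul_one, Pi.smul_apply, smul_eq_mul,
    single_vecMul] at h
  have hsub : B.submatrix (Fin.succAbove 0) (Fin.succAbove 0) =
      Matrix.of fun i j => z j (Fin.succ i) := by
    ext i j
    simp [hB]
  rw [mul_comm, h, Matrix.row_apply, adjugate_fin_succ_eq_det_submatrix, hsub]
  simp

/-- Cancel the common factor: a prime dividing one of the coprime remainders would have to divide
the other as well. -/
lemma associated_of_forall_prime {S : Type*} [CommRing S] [IsDomain S]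
    [UniqueFactorizationMonoid S] {f g : S} (hf : f ≠ 0) (hg : g ≠ 0)
    (h : ∀ p, Prime p → ∃ x y, ¬ p ∣ x ∧ ¬ p ∣ y ∧ f * x = y * g) : Associated f g := by
  obtain ⟨f', g', c, hrel, rfl, rfl⟩ := UniqueFactorizationMonoid.exists_reduced_factors f hf g
  have hc : c ≠ 0 := left_ne_zero_of_mul hf
  have key : ∀ p, Prime p → ∃ x y, ¬ p ∣ x ∧ ¬ p ∣ y ∧ f' * x = y * g' := fun p hp => by
    obtain ⟨x, y, hx, hy, hxy⟩ := h p hp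
    refine ⟨x, y, hx, hy, mul_left_cancel₀ hc ?_⟩
    rw [← mul_assoc, hxy]
    ring
  have hunit : IsUnit f' ∧ IsUnit g' := by
    constructor
    · by_contra hu
      obtain ⟨p, hp, hpf⟩ := WfDvdMonoid.exists_irreducible_factor hu (right_ne_zero_of_mul hf)
      obtain ⟨x, y, -, hy, hxy⟩ := key p hp.prime
      have := (hp.prime.dvd_or_dvd (hxy ▸ hpf.mul_right x)).resolve_left hy
      exact hp.not_isUnit (hrel hpf this)
    · by_contra hu
      obtain ⟨p, hp, hpg⟩ := WfDvdMonoid.exists_irreducible_factor hu (right_ne_zero_of_mul hg)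
      obtain ⟨x, y, hx, -, hxy⟩ := key p hp.prime
      have := (hp.prime.dvd_or_dvd (hxy ▸ hpg.mul_left y)).resolve_right hx
      exact hp.not_isUnit (hrel this hpg)
  exact (associated_mul_unit_right c f' hunit.1).symm.trans (associated_mul_unit_right c g' hunit.2)

/-- The Hilbert--Burch theorem in the following form: if `z` is a basis of the syzygies of `G` and no
prime divides all elements of the ideal generated by `G`, then `G 0` is the corresponding maximal
minor of `z` up to a unit. -/
lemma associated_det_of_span_eq_ker {S : Type*} [CommRing S] [IsDomain S]
    [UniqueFactorizationMonoid S] {t : ℕ} {G : Fin (t + 1) → S} (hG0 : G 0 ≠ 0)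
    (hGu : ¬ IsUnit (G 0)) {z : Fin t → Fin (t + 1) → S} (hz : LinearIndependent S z)
    (hspan : Submodule.span S (Set.range z) = LinearMap.ker (Fintype.linearCombination S G))
    (hprime : ∀ p, Prime p → ∃ γ ∈ Ideal.span (Set.range G), ¬ p ∣ γ) :
    Associated (G 0) (Matrix.of fun i j => z j (Fin.succ i)).det := by
  have hzG : ∀ j, z j ⬝ᵥ G = 0 := fun j => by
    have : z j ∈ LinearMap.ker (Fintype.linearCombination S G) :=
      hspan ▸ Submodule.subset_span ⟨j, rfl⟩
    exact LinearMap.mem_ker.mp this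
  have key : ∀ p, Prime p → ∃ x y, ¬ p ∣ x ∧ ¬ p ∣ y ∧
      G 0 * x = y * (Matrix.of fun i j => z j (Fin.succ i)).det := by
    intro p hp
    obtain ⟨γ, hγ, hpγ⟩ := hprime p hp
    rw [← Ideal.submodule_span_eq, ← Fintype.range_linearCombination] at hγ
    obtain ⟨c, rfl⟩ := hγ
    exact ⟨_, _, not_dvd_det_cons hz hspan hp c hpγ, hpγ, mul_det_cons_eq hzG c⟩
  refine associated_of_forall_prime hG0 (fun h0 => ?_) key
  obtain ⟨p, hp, -⟩ := WfDvdMonoid.exists_irreducible_factor hGu hG0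
  obtain ⟨x, y, hx, -, hxy⟩ := key p hp.prime
  rw [h0, mul_zero] at hxy
  exact hx ((mul_eq_zero.mp hxy).resolve_left hG0 ▸ dvd_zero p)

/-- Pigeonhole: the indices up to `i` outnumber the values below `i`. -/
lemma exists_le_apply_perm {t : ℕ} (σ : Equiv.Perm (Fin t)) (i : Fin t) :
    ∃ j ≤ i, i ≤ σ j := by
  by_contra! h
  have := Finset.card_le_card_of_injOn (s := Finset.Iic i) (t := Finset.Iio i) σ
    (fun j hj => by simpa using h j (by simpa using hj)) σ.injective.injOn
  simp at this

/-- A matrix with entries vanishing where `b j ≤ a i`, for monotone `a` and `b`, is singular unless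
`a i < b i` for all `i`. -/
lemma lt_of_det_ne_zero {S : Type*} [CommRing S] {t : ℕ} {a b : Fin t → ℤ}
    (ha : Monotone a) (hb : Monotone b) {M : Matrix (Fin t) (Fin t) S}
    (hM : ∀ i j, b j ≤ a i → M i j = 0) (hdet : M.det ≠ 0) (i : Fin t) : a i < b i := by
  by_contra! h
  apply hdet
  rw [det_apply]
  refine Finset.sum_eq_zero fun σ _ => ?_
  -- If `b i ≤ a i`, the entries in rows from `i` on and columns up to `i` vanish, and every
  -- permutation meets this block.
  obtain ⟨j, hj, hij⟩ := exists_le_apply_perm σ i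
  have h0 : ∏ k, M (σ k) k = 0 := Finset.prod_eq_zero (Finset.mem_univ j)
    (hM _ _ ((hb hj).trans (h.trans (ha hij))))
  exact (congrArg _ h0).trans (smul_zero _)

lemma isHomogeneous_det {σ K : Type*} [CommRing K] {t : ℕ} {a b : Fin t → ℤ}
    {M : Matrix (Fin t) (Fin t) (MvPolynomial σ K)}
    (hM : ∀ i j, a i < b j → (M i j).IsHomogeneous (b j - a i).toNat)
    (hM0 : ∀ i j, b j ≤ a i → M i j = 0) :
    M.det.IsHomogeneous (∑ i, (b i - a i)).toNat := by
  rw [det_apply]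
  refine IsHomogeneous.sum _ _ _ fun τ _ => ?_
  rw [Units.smul_def]
  have hprod : (∏ j, M (τ j) j).IsHomogeneous (∑ i, (b i - a i)).toNat := by
    by_cases h : ∃ j, b j ≤ a (τ j)
    · obtain ⟨j, hj⟩ := h
      have h0 : ∏ k, M (τ k) k = 0 := Finset.prod_eq_zero (Finset.mem_univ j) (hM0 _ _ hj)
      exact h0 ▸ isHomogeneous_zero _ _ _
    · push Not at h
      -- In a term with no forced zero all differences are positive, so truncation is harmless and
      -- the total does not depend on `τ`.
      have hsum : (∑ i, (b i - a i)).toNat = ∑ j, (b j - a (τ j)).toNat := by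
        have : ∑ i, (b i - a i) = ((∑ j, (b j - a (τ j)).toNat : ℕ) : ℤ) := by
          push_cast
          rw [Finset.sum_congr rfl fun j _ => Int.toNat_of_nonneg (sub_nonneg.mpr (h j).le),
            Finset.sum_sub_distrib, Finset.sum_sub_distrib, Equiv.sum_comp τ a]
        rw [this, Int.toNat_natCast]
      rw [hsum]
      exact IsHomogeneous.prod _ _ _ fun j _ => hM _ _ (h j)
  rcases Int.units_eq_one_or (Equiv.Perm.sign τ) with h | h <;> rw [h]
  · simpa using hprod
  · simpa using hprod.neg

/-- A matrix of forms whose determinant is `F` up to a unit can be sorted and rescaled. -/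
lemma exists_isWeakDeterminantal {n : ℕ} {K : Type u} [Field K]
    {F : MvPolynomial (Fin (n + 1)) K} {d : ℕ} (hF : F.IsHomogeneous d) (hF0 : F ≠ 0) {t : ℕ}
    (ht : 2 ≤ t) {a b : Fin t → ℤ} {M : Matrix (Fin t) (Fin t) (MvPolynomial (Fin (n + 1)) K)}
    (hM : ∀ i j, a i < b j → (M i j).IsHomogeneous (b j - a i).toNat)
    (hM0 : ∀ i j, b j ≤ a i → M i j = 0) (hdet : Associated M.det F) :
    ∃ (t : ℕ) (a b : Fin t → ℤ),
      IsWeakAdmissiblePair a b ∧ pairDegree a b = (d : ℤ) ∧ IsWeakDeterminantal F a b := by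
  set a' := a ∘ Tuple.sort a with ha'
  set b' := b ∘ Tuple.sort b with hb'
  set M' := (M.submatrix (Tuple.sort a) id).submatrix id (Tuple.sort b) with hM'
  have hsign : ∀ τ : Equiv.Perm (Fin t),
      IsUnit ((Equiv.Perm.sign τ : ℤ) : MvPolynomial (Fin (n + 1)) K) := fun τ =>
    (Equiv.Perm.sign τ).isUnit.map (Int.castRingHom (MvPolynomial (Fin (n + 1)) K))
  have hdet' : Associated M'.det F := by
    rw [hM', det_permute', det_permute]
    exact (associated_unit_mul_left _ _ (hsign _)).trans
      ((associated_unit_mul_left _ _ (hsign _)).trans hdet)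
  obtain ⟨u, hu⟩ := hdet'
  have huh : (u : MvPolynomial (Fin (n + 1)) K).IsHomogeneous 0 := by
    obtain ⟨c, -, hc⟩ := MvPolynomial.isUnit_iff_eq_C_of_isReduced.mp u.isUnit
    rw [hc]
    exact isHomogeneous_C _ _
  -- Sorting changed the determinant by signs only. The remaining unit is a constant, so it can be
  -- absorbed into one row without changing degrees.
  let N := M'.updateRow ⟨0, by omega⟩ ((u : MvPolynomial (Fin (n + 1)) K) • M' ⟨0, by omega⟩)
  have hN : ∀ i j, N i j = M' i j ∨ N i j = u * M' i j := by
    intro i j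
    by_cases h : i = ⟨0, by omega⟩
    · right
      rw [h]
      simp [N]
    · left
      simp [N, updateRow_ne h]
  have hNdet : F = N.det := by
    rw [det_updateRow_smul, updateRow_eq_self, mul_comm, hu]
  have hN1 : ∀ i j, a' i < b' j → (N i j).IsHomogeneous (b' j - a' i).toNat := by
    intro i j hij
    have h1 : (M' i j).IsHomogeneous (b' j - a' i).toNat := hM _ _ hij
    rcases hN i j with h | h <;> rw [h]
    · exact h1
    · simpa using huh.mul h1
  have hN0 : ∀ i j, b' j ≤ a' i → N i j = 0 := by
    intro i j hij
    have h1 : M' i j = 0 := hM0 _ _ hij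
    rcases hN i j with h | h <;> simp [h, h1]
  have hlt := lt_of_det_ne_zero (Tuple.monotone_sort a) (Tuple.monotone_sort b) hN0
    (hNdet ▸ hF0)
  refine ⟨t, a', b', ⟨ht, Tuple.monotone_sort a, Tuple.monotone_sort b, hlt⟩, ?_,
    N, hNdet, hN1, hN0⟩
  have hdeg := (isHomogeneous_det hN1 hN0).inj_right (hNdet ▸ hF) (hNdet ▸ hF0)
  rw [pairDegree, ← hdeg, Int.toNat_of_nonneg]
  exact Finset.sum_nonneg fun i _ => (sub_pos.mpr (hlt i)).le

end Determinant

/-! ### Assembling the determinantal representation. -/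

section CodimensionTwo

open MvPolynomial

variable {n : ℕ} {K : Type u} [Field K]

/-- In a homogeneous syzygy of forms which are irredundant modulo `F`, the entries of degree zero
vanish. -/
lemma eq_zero_of_isHomogeneous_zero {t : ℕ} {F : MvPolynomial (Fin (n + 1)) K}
    {g : Fin t → MvPolynomial (Fin (n + 1)) K} {i : Fin t}
    (hirr : g i ∉ Submodule.span (MvPolynomial (Fin (n + 1)) K) (g '' {i}ᶜ) ⊔
      Submodule.span (MvPolynomial (Fin (n + 1)) K) {F})
    {v : Fin (t + 1) → MvPolynomial (Fin (n + 1)) K}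
    (hv : v ∈ LinearMap.ker (Fintype.linearCombination (MvPolynomial (Fin (n + 1)) K)
      (Fin.cons F g : Fin (t + 1) → MvPolynomial (Fin (n + 1)) K)))
    (hvi : (v i.succ).IsHomogeneous 0) : v i.succ = 0 := by
  classical
  obtain ⟨c, hc⟩ : ∃ c, v i.succ = C c :=
    ⟨_, totalDegree_eq_zero_iff_eq_C.mp (Nat.le_zero.mp hvi.totalDegree_le)⟩
  by_contra h0
  have hc0 : c ≠ 0 := by
    rintro rfl
    exact h0 (by rw [hc, C_0])
  apply hirr
  rw [LinearMap.mem_ker, Fintype.linearCombination_apply, Fin.sum_univ_succ] at hv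
  simp only [Fin.cons_zero, Fin.cons_succ] at hv
  rw [← Finset.add_sum_erase _ _ (Finset.mem_univ i), add_left_comm, hc] at hv
  have hmem : C (σ := Fin (n + 1)) c • g i ∈
      Submodule.span (MvPolynomial (Fin (n + 1)) K) (g '' {i}ᶜ) ⊔
        Submodule.span (MvPolynomial (Fin (n + 1)) K) {F} := by
    rw [eq_neg_of_add_eq_zero_left hv]
    refine Submodule.neg_mem _ (Submodule.add_mem _ ?_ ?_)
    · exact Submodule.mem_sup_right (Submodule.smul_mem _ _ (Submodule.mem_span_singleton_self F))
    · exact Submodule.mem_sup_left (Submodule.sum_mem _ fun k hk => Submodule.smul_mem _ _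
        (Submodule.subset_span ⟨k, Finset.ne_of_mem_erase hk, rfl⟩))
  have := Submodule.smul_mem _ (C (σ := Fin (n + 1)) c⁻¹) hmem
  rwa [smul_smul, ← C_mul, inv_mul_cancel₀ hc0, C_1, one_smul] at this

/-- A form in a homogeneous ideal of height two which is not a complete intersection and has
Cohen--Macaulay quotient is the determinant of a matrix of forms. -/
lemma exists_isWeakDeterminantal_of_mem {F : MvPolynomial (Fin (n + 1)) K} {d : ℕ}
    (hF : F.IsHomogeneous d) (hF0 : F ≠ 0) {T : Set (MvPolynomial (Fin (n + 1)) K)}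
    (hT : ∀ f ∈ T, ∃ e, f.IsHomogeneous e) (hFI : F ∈ Ideal.span T)
    (hI : ((Ideal.span T).map (Ideal.Quotient.mk (Ideal.span {F}))).height = 1)
    (hCM : IsCohenMacaulayRing (MvPolynomial (Fin (n + 1)) K ⧸ Ideal.span T))
    (hCI : ¬ ∃ (r : ℕ) (g : Fin r → MvPolynomial (Fin (n + 1)) K),
      (∀ k, ∃ e : ℕ, (g k).IsHomogeneous e) ∧ Ideal.span (Set.range g) = Ideal.span T ∧
        (Ideal.span T).height = (r : ℕ∞)) :
    ∃ (t : ℕ) (a b : Fin t → ℤ),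
      IsWeakAdmissiblePair a b ∧ pairDegree a b = (d : ℤ) ∧ IsWeakDeterminantal F a b := by
  have hheight := height_eq_two_of_height_map hF0 hFI hI
  have hFu : ¬ IsUnit F := fun h => by
    rw [Ideal.eq_top_of_isUnit_mem _ hFI h, Ideal.height_top] at hheight
    exact absurd hheight (by decide)
  -- Only the `g j` are irredundant, modulo `F`; `F` itself may be superfluous. Constant entries can
  -- thus occur only in the row of `F`, which the minor omits.
  obtain ⟨t, g, hgT, hgspan, hgirr⟩ := exists_irredundant_family
    (R := MvPolynomial (Fin (n + 1)) K) T (IsNoetherian.noetherian _)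
    (Submodule.span (MvPolynomial (Fin (n + 1)) K) {F})
  choose e he using fun j => hT _ (hgT j)
  set G : Fin (t + 1) → MvPolynomial (Fin (n + 1)) K := Fin.cons F g with hG
  set eG : Fin (t + 1) → ℕ := Fin.cons d e with heG
  have hGe : ∀ i, (G i).IsHomogeneous (eG i) := fun i => by
    refine Fin.cases ?_ (fun j => ?_) i
    · exact hF
    · exact he j
  have hGspan : Ideal.span (Set.range G) = Ideal.span T := by
    rw [hG, Fin.range_cons, Ideal.span_insert, sup_comm]
    exact hgspan.trans (sup_eq_left.mpr ((Ideal.span_singleton_le_iff_mem _).mpr hFI))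
  have ht : 2 ≤ t := by
    by_contra! h
    interval_cases t
    · rw [← hGspan, hG, Fin.range_cons, Set.range_eq_empty, insert_empty_eq] at hheight
      have := Ideal.height_span_singleton_le_one hFu
      rw [hheight] at this
      exact absurd this (by decide)
    · exact hCI ⟨2, G, fun k => ⟨_, hGe k⟩, hGspan, hheight⟩
  obtain ⟨s, z, hzT, hzspan, hzirr⟩ := exists_irredundant_family
    (R := MvPolynomial (Fin (n + 1)) K) _
    (IsNoetherian.noetherian (Submodule.span _ {v | v ∈ LinearMap.ker
        (Fintype.linearCombination (MvPolynomial (Fin (n + 1)) K) G) ∧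
          ∃ D, IsHomogeneousVector eG D v})) ⊥
  rw [span_homogeneous_ker hGe, sup_bot_eq, sup_bot_eq] at hzspan
  simp only [sup_bot_eq] at hzirr
  choose hzker D hD using hzT
  have hhom : (Ideal.span T).IsHomogeneous (homogeneousSubmodule (Fin (n + 1)) K) :=
    Ideal.homogeneous_span _ _ fun f hf => by
      obtain ⟨e, he⟩ := hT f hf
      exact ⟨e, he⟩
  have hpd := hasProjectiveDimensionLE_two_localization hhom hF0 hFI hI hCM
  rw [← hGspan] at hpd
  have hzli := linearIndependent_of_minimal (idealOfVars (Fin (n + 1)) K) hpd hzspan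
    fun c hc j => mem_idealOfVars_iff.mpr
      (constantCoeff_eq_zero_of_sum_smul_eq_zero hD (hzirr j) hc)
  obtain rfl := eq_of_span_eq_ker_linearCombination (G := G) hF0 hzli hzspan
  -- A prime element dividing all of `I` would put `I` inside a principal prime, of height at most
  -- one.
  have hdet := associated_det_of_span_eq_ker (G := G) hF0 hFu hzli hzspan fun p hp => by
    by_contra! h
    have hpp : (Ideal.span {p}).IsPrime := (Ideal.span_singleton_prime hp.ne_zero).mpr hp
    have h2 := two_le_height_of_height_map hF0 hFI hI (Ideal.span {p}) fun γ hγ =>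
      Ideal.mem_span_singleton.mpr (h γ (hGspan ▸ hγ))
    exact absurd (h2.trans (Ideal.height_span_singleton_le_one hp.not_isUnit)) (by decide)
  refine exists_isWeakDeterminantal hF hF0 ht (a := fun i => (e i : ℤ)) (b := fun j => (D j : ℤ))
    (fun i j hij => ?_) (fun i j hij => ?_) hdet.symm
  · have hlt : e i < D j := by exact_mod_cast hij
    have : ((D j : ℤ) - (e i : ℤ)).toNat = D j - e i := by omega
    rw [this]
    exact (hD j i.succ).1 hlt.le
  · have hle : D j ≤ e i := by exact_mod_cast hij
    rcases hle.lt_or_eq with h | h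
    -- When `D j = e i` the entry is a constant, so its vanishing needs irredundancy and not just
    -- the degree.
    · exact (hD j i.succ).2 h
    · refine eq_zero_of_isHomogeneous_zero (hgirr i) (hzker j) ?_
      have := (hD j i.succ).1 h.ge
      have h0 : D j - eG i.succ = 0 := by
        rw [h]
        exact Nat.sub_self _
      rwa [h0] at this

end CodimensionTwo

theorem mainTheorem10 (n : ℕ) (K : Type u) [Field K]
    (F : MvPolynomial (Fin (n + 1)) K) (d : ℕ) (hd : 0 < d) (hF : F.IsHomogeneous d) (hF0 : F ≠ 0)
    (Y : Scheme.{u}) (i : Y ⟶ projSpace n K) [IsClosedImmersion i]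
    (hYX : FormVanishesOn i F d hF)
    (hcodim : codimInHypersurface i F = 1)
    (hACM : IsACM i)
    (hCI : ¬ IsCompleteIntersectionIn i) :
    ∃ (t : ℕ) (a b : Fin t → ℤ),
      IsWeakAdmissiblePair a b ∧ pairDegree a b = (d : ℤ) ∧ IsWeakDeterminantal F a b :=
  exists_isWeakDeterminantal_of_mem hF hF0
    -- The geometric conditions on `Y` unfold to algebraic ones on the ideal spanned by the forms
    -- vanishing on it.
    (T := {f | ∃ (d : ℕ) (hf : f.IsHomogeneous d), FormVanishesOn i f d hf}) (fun _ ⟨e, he, _⟩ => ⟨e, he⟩)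
    (Ideal.subset_span ⟨d, hF, hYX⟩) hcodim hACM hCI
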